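/- For a finite field $\mathbb F_q$ let $\mathcal M_N$ be the set of monic polynomials of degree $N$ in $\mathbb F_q[t]$, and for a nonconstant $F$ let $P^-(F)$ be the least degree of a monic irreducible divisor of $F$. A Steinhaus random multiplicative function $f$ over $\mathbb F_q[t]$ is obtained from independent random variables $(f(P))_P$, indexed by the monic irreducible polynomials $P$ and uniformly distributed on the complex unit circle, by setting $f(1)=1$ and $f(P_1^{a_1}\cdots P_r^{a_r})=f(P_1)^{a_1}\cdots f(P_r)^{a_r}$ for distinct monic irreducibles $P_1,\dots,P_r$. Let $\mathcal{CN}(0,1)$ be the law of $X+iY$ with $X,Y$ independent real normal variables of mean $0$ and variance $1/2$. Theorem. Let $q\ge 2$ be a prime power, $N\ge 1$ an integer, and $z$ an integer with $N^{1/2}\le z\le N-1$ and $N^{1/2}=o(z)$ as $N\to\infty$. Let $f$ be a Steinhaus random multiplicative function over $\mathbb F_q[t]$, and put $$\mathcal A=\{F\in\mathcal M_N : P^-(F)>z\}.$$ Then $$\frac{1}{\sqrt{|\mathcal A|}}\sum_{F\in\mathcal A} f(F)\ \xrightarrow{d}\ \mathcal{CN}(0,1)\qquad\text{as } N\to\infty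 .$$ Here $q$ and $z$ may vary arbitrarily with $N$ subject to these conditions: the convergence holds along every family of triples $(q,N,z)$ satisfying the hypotheses with $N\to\infty$. -/

import Mathlib

open MeasureTheory ProbabilityTheory Filter Asymptotics Polynomial

namespace RoughCLT

/-- The uniform probability measure on the unit circle, as a measure on `ℂ`: the law of
`exp (2 π i θ)` for `θ` uniform on the unit interval. -/
noncomputable def uniformCircle : Measure ℂ :=
  (volume.restrict (Set.Ioc (0 : ℝ) 1)).map
    (fun θ : ℝ => Complex.exp (2 * Real.pi * θ * Complex.I))

/-- The standard complex normal law with mean `0` and variance `1`: the real and imaginary parts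
are independent real Gaussians of mean `0` and variance `1 / 2`. -/
noncomputable def stdComplexNormal : Measure ℂ :=
  ((gaussianReal 0 (1 / 2)).prod (gaussianReal 0 (1 / 2))).map
    (fun p : ℝ × ℝ => (p.1 : ℂ) + p.2 * Complex.I)

instance : IsProbabilityMeasure stdComplexNormal :=
  Measure.isProbabilityMeasure_map (by fun_prop)

/-- A Steinhaus random multiplicative function over `K[t]` on the probability space `(Ω, μ)`.
Only the values of `f` at monic polynomials are relevant (and constrained). -/
structure IsSteinhaus {K Ω : Type*} [Field K] [MeasurableSpace Ω] (μ : Measure Ω)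
    (f : K[X] → Ω → ℂ) : Prop where
  /-- at each prime the value is uniformly distributed on the unit circle -/
  hasLaw : ∀ P : K[X], P.Monic → Irreducible P → HasLaw (f P) uniformCircle μ
  /-- the values at the primes are mutually independent -/
  indep : iIndepFun (fun P : {P : K[X] // P.Monic ∧ Irreducible P} => f P.1) μ
  /-- `f (P₁ ^ a₁ ⋯ Pᵣ ^ aᵣ) = f P₁ ^ a₁ ⋯ f Pᵣ ^ aᵣ` for distinct primes `Pᵢ`;
  the empty product gives `f 1 = 1` -/
  map_prod : ∀ (s : Finset K[X]) (a : K[X] → ℕ), (∀ P ∈ s, P.Monic ∧ Irreducible P) →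
    ∀ ω, f (∏ P ∈ s, P ^ a P) ω = ∏ P ∈ s, f P ω ^ a P

/-- `P⁻(F)`: the least degree of a monic irreducible divisor of `F` (`⊤` if there is none). -/
noncomputable def minPrimeDegree {K : Type*} [Field K] (F : K[X]) : ℕ∞ :=
  sInf {d : ℕ∞ | ∃ P : K[X], P.Monic ∧ Irreducible P ∧ P ∣ F ∧ d = P.natDegree}

/-- The monic polynomials of degree `N` all of whose prime factors have degree exceeding `z`. -/
def roughSet (K : Type*) [Field K] (N z : ℕ) : Set K[X] :=
  {F | F.Monic ∧ F.natDegree = N ∧ (z : ℕ∞) < minPrimeDegree F}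

theorem roughSet_finite (K : Type*) [Field K] [Finite K] (N z : ℕ) :
    (roughSet K N z).Finite := by
  have h : Set.InjOn (fun (F : K[X]) (i : Fin (N + 1)) => F.coeff i) (roughSet K N z) := by
    intro F hF G hG hFG
    ext n
    by_cases hn : n < N + 1
    · exact congrFun hFG ⟨n, hn⟩
    · rw [coeff_eq_zero_of_natDegree_lt (by have := hF.2.1; omega),
        coeff_eq_zero_of_natDegree_lt (by have := hG.2.1; omega)]
  exact Set.Finite.of_injOn (Set.mapsTo_univ _ _) h Set.finite_univ

/-- The finite set of monic `z`-rough polynomials of degree `N` over the finite field `K`. -/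
noncomputable def rough (K : Type*) [Field K] [Finite K] (N z : ℕ) : Finset K[X] :=
  (roughSet_finite K N z).toFinset

/-- The normalized partial sum `|A|^{-1/2} ∑_{F ∈ A} f(F)`. -/
noncomputable def normalizedSum {K Ω : Type*} [Field K] (f : K[X] → Ω → ℂ) (A : Finset K[X])
    (ω : Ω) : ℂ :=
  (1 / Real.sqrt (A.card : ℝ) : ℝ) * ∑ F ∈ A, f F ω

end RoughCLT

/-! The proof is Stein's method on the infinite torus indexed by the primes, where f(F) becomes a
character χ_F. Rotating the coordinate at P by s preserves Haar measure and multiplies χ_F by exp(i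
s v_P(F)). Since Σ_P (deg P / N) v_P(F) = deg F / N = 1, the normalized sum S is the sum of its
P-derivatives with weights deg P / N, up to the factor i. With e = exp(i Re(t̄S)), integration by
parts (`IsRotated.integral_sum_mul_exp`) gives E[S e] = (it/2) E[Γ e] - (it̄/2) E[Γ' e]. Here Γ and
Γ' are |A|⁻¹ times sums of χ_F χ̄_G and χ_F χ_G over pairs sharing a prime, with weights in [0,1].
If Γ ≈ 1 and Γ' ≈ 0 in L¹, then φ(r) = E exp(i r Re(t̄S)) nearly solves φ' = -(r|t|²/2) φ, so φ(1) ≈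
exp(-|t|²/4) (`IsRotated.norm_integral_expRe_sub_le`).

The diagonal F = G contributes exactly 1 to Γ. The rest is bounded in L² by counting solutions of
F₁F₂ = F₃F₄ in A. A nontrivial solution has the shape (xu)(wy) = (xw)(uy) (`rough_quadruple`), so
there are at most E = Σ_{0<m<N} A_m² A_{N-m}² of them, A_m being the number of rough polynomials of
degree m. The shared prime is essential: it cuts the trivial solutions from order |A|² to O(|A| +
E).

Finally, deg F = Σ_{P^k ∣ F} deg P yields a recursion for A_m, whence A_m ≤ q^m / z for m ≥ 1 and
A_N ≥ q^N / (4z) for large z with z < N ≤ z². So E / |A|² ≤ 16 N / z², which tends to 0 because √N =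
o(z). -/

namespace RoughCLT

/-! ### Rough polynomials and unique factorization -/

section Arithmetic

variable {K : Type*} [Field K]

/-- The type of monic irreducible polynomials. -/
abbrev PrimePoly (K : Type*) [Field K] : Type _ := {P : K[X] // P.Monic ∧ Irreducible P}

theorem PrimePoly.prime (P : PrimePoly K) : Prime P.1 := P.2.2.prime

theorem PrimePoly.natDegree_pos (P : PrimePoly K) : 0 < P.1.natDegree := P.2.2.natDegree_pos

theorem PrimePoly.finiteMultiplicity (P : PrimePoly K) {F : K[X]} (hF : F ≠ 0) :
    FiniteMultiplicity P.1 F :=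
  FiniteMultiplicity.of_prime_left P.prime hF

theorem lt_minPrimeDegree_iff (z : ℕ) (F : K[X]) :
    (z : ℕ∞) < minPrimeDegree F ↔ ∀ P : PrimePoly K, P.1 ∣ F → z < P.1.natDegree := by
  constructor
  · intro h P hP
    exact_mod_cast h.trans_le (sInf_le ⟨P.1, P.2.1, P.2.2, hP, rfl⟩)
  · intro h
    refine (ENat.add_one_le_iff (ENat.natCast_ne_top z)).1 (le_sInf ?_)
    rintro _ ⟨P, hP, hP', hPF, rfl⟩
    exact_mod_cast h ⟨P, hP, hP'⟩ hPF

variable [Finite K]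

theorem mem_rough {N z : ℕ} {F : K[X]} : F ∈ rough K N z ↔
    F.Monic ∧ F.natDegree = N ∧ ∀ P : PrimePoly K, P.1 ∣ F → z < P.1.natDegree := by
  simp [rough, roughSet, lt_minPrimeDegree_iff]

theorem rough_mul {m n z : ℕ} {F G : K[X]} (hF : F ∈ rough K m z) (hG : G ∈ rough K n z) :
    F * G ∈ rough K (m + n) z := by
  rw [mem_rough] at *
  refine ⟨hF.1.mul hG.1, ?_, fun P hP => ?_⟩
  · rw [hF.1.natDegree_mul hG.1, hF.2.1, hG.2.1]
  · exact (P.prime.dvd_or_dvd hP).elim (hF.2.2 P) (hG.2.2 P)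

theorem rough_of_dvd {n z : ℕ} {F G : K[X]} (hF : F ∈ rough K n z) (hG : G.Monic) (h : G ∣ F) :
    G ∈ rough K G.natDegree z := by
  rw [mem_rough] at *
  exact ⟨hG, rfl, fun P hP => hF.2.2 P (hP.trans h)⟩

theorem mem_rough_zero {N : ℕ} {F : K[X]} :
    F ∈ rough K N 0 ↔ F.Monic ∧ F.natDegree = N := by
  rw [mem_rough]
  exact ⟨fun h => ⟨h.1, h.2.1⟩, fun h => ⟨h.1, h.2, fun P _ => P.natDegree_pos⟩⟩

theorem eq_one_of_mem_rough {z : ℕ} {F : K[X]} (hF : F ∈ rough K 0 z) : F = 1 :=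
  (mem_rough.1 hF).1.natDegree_eq_zero.1 (mem_rough.1 hF).2.1

theorem one_mem_rough (z : ℕ) : (1 : K[X]) ∈ rough K 0 z := by
  rw [mem_rough]
  exact ⟨monic_one, natDegree_one, fun P hP => (P.prime.not_dvd_one hP).elim⟩

theorem rough_zero_left (z : ℕ) : rough K 0 z = {1} := by
  ext F
  rw [Finset.mem_singleton]
  exact ⟨eq_one_of_mem_rough, fun h => h ▸ one_mem_rough z⟩

theorem rough_eq_empty {m z : ℕ} (h0 : 0 < m) (h : m ≤ z) : rough K m z = ∅ := by
  refine Finset.eq_empty_of_forall_notMem fun F hF => ?_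
  rw [mem_rough] at hF
  obtain ⟨P, hP, hP', hPF⟩ := exists_monic_irreducible_factor F
    (not_isUnit_of_natDegree_pos F (hF.2.1 ▸ h0))
  have h1 := hF.2.2 ⟨P, hP, hP'⟩ hPF
  have h2 := natDegree_le_of_dvd hPF hF.1.ne_zero
  simp only at h1
  omega

theorem card_rough_zero (m : ℕ) : (rough K m 0).card = Nat.card K ^ m := by
  have e : (rough K m 0 : Set K[X]) ≃ {p : K[X] // p.Monic ∧ p.natDegree = m} :=
    Equiv.subtypeEquivRight fun F => by simpa using mem_rough_zero
  have h := Nat.card_congr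
    (e.trans ((monicEquivDegreeLT m).trans (degreeLTEquiv K m).toEquiv))
  simpa [Nat.card_fun] using h

theorem finite_primePoly_natDegree_le (M : ℕ) : {P : PrimePoly K | P.1.natDegree ≤ M}.Finite := by
  refine Set.Finite.of_finite_image (f := Subtype.val) ?_ Subtype.val_injective.injOn
  refine ((Set.finite_Iic M).biUnion fun m _ => (rough K m 0).finite_toSet).subset ?_
  rintro _ ⟨P, hP, rfl⟩
  exact Set.mem_biUnion (Set.mem_Iic.2 hP) (mem_rough_zero.2 ⟨P.2.1, rfl⟩)

variable (K) in
/-- The finite set of monic irreducible polynomials of degree at most `M`. -/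
noncomputable def primesLE (M : ℕ) : Finset (PrimePoly K) :=
  (finite_primePoly_natDegree_le M).toFinset

theorem mem_primesLE {M : ℕ} {P : PrimePoly K} : P ∈ primesLE K M ↔ P.1.natDegree ≤ M := by
  simp [primesLE]

/-- Taking all primes of degree at most M, not just the divisors of F, makes the index set
independent of F. -/
theorem prod_pow_multiplicity {M : ℕ} {F : K[X]} (hF : F.Monic) (hM : F.natDegree ≤ M) :
    ∏ P ∈ primesLE K M, P.1 ^ multiplicity P.1 F = F := by
  classical
  have h1 := leadingCoeff_mul_prod_normalizedFactors F
  rw [hF.leadingCoeff, C_1, one_mul, Finset.prod_multiset_count] at h1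
  have hsub : (UniqueFactorizationMonoid.normalizedFactors F).toFinset ⊆
      (primesLE K M).map (Function.Embedding.subtype _) := by
    intro P hP
    rw [Multiset.mem_toFinset, Polynomial.mem_normalizedFactors_iff hF.ne_zero] at hP
    rw [Finset.mem_map]
    exact ⟨⟨P, hP.2.1, hP.1⟩,
      mem_primesLE.2 ((natDegree_le_of_dvd hP.2.2 hF.ne_zero).trans hM), rfl⟩
  rw [Finset.prod_subset hsub, Finset.prod_map] at h1
  · conv_rhs => rw [← h1]
    refine Finset.prod_congr rfl fun P _ => ?_
    have := UniqueFactorizationMonoid.multiplicity_eq_count_normalizedFactors P.2.2 hF.ne_zero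
    rw [this, P.2.1.normalize_eq_self]
    rfl
  · intro P _ hP
    rw [Multiset.mem_toFinset] at hP
    rw [Multiset.count_eq_zero_of_notMem hP, pow_zero]

theorem sum_multiplicity_mul_natDegree {M : ℕ} {F : K[X]} (hF : F.Monic) (hM : F.natDegree ≤ M) :
    ∑ P ∈ primesLE K M, multiplicity P.1 F * P.1.natDegree = F.natDegree := by
  conv_rhs => rw [← prod_pow_multiplicity hF hM]
  rw [natDegree_prod_of_monic _ _ fun P _ => P.2.1.pow _]
  simp [natDegree_pow]

theorem eq_of_multiplicity_eq {M : ℕ} {F G : K[X]} (hF : F.Monic) (hG : G.Monic)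
    (hFM : F.natDegree ≤ M) (hGM : G.natDegree ≤ M)
    (h : ∀ P ∈ primesLE K M, multiplicity P.1 F = multiplicity P.1 G) : F = G := by
  rw [← prod_pow_multiplicity hF hFM, ← prod_pow_multiplicity hG hGM]
  exact Finset.prod_congr rfl fun P hP => by rw [h P hP]

omit [Finite K] in
theorem multiplicity_mul_of_monic {F G : K[X]} (hF : F.Monic) (hG : G.Monic) (P : PrimePoly K) :
    multiplicity P.1 (F * G) = multiplicity P.1 F + multiplicity P.1 G :=
  multiplicity_mul P.prime (P.finiteMultiplicity (hF.mul hG).ne_zero)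

omit [Finite K] in
theorem multiplicity_pos_iff_dvd {F : K[X]} (hF : F.Monic) (P : PrimePoly K) :
    0 < multiplicity P.1 F ↔ P.1 ∣ F := by
  simpa [Nat.one_le_iff_ne_zero, Nat.pos_iff_ne_zero] using ((P.finiteMultiplicity hF.ne_zero).pow_dvd_iff_le_multiplicity (k := 1)).symm

end Arithmetic

/-! ### The recursion for rough counts and the prime polynomial theorem -/

section Counting

variable (K : Type*) [Field K] [Finite K]

/-- The sum of `deg P` over prime powers `P ^ k` of degree `j` with `z < deg P`; the cutoff `M`
only serves to make the sum finite. -/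
noncomputable def mangoldtSum (M z j : ℕ) : ℕ :=
  ∑ P ∈ primesLE K M, ∑ k ∈ Finset.Icc 1 M,
    if z < P.1.natDegree ∧ k * P.1.natDegree = j then P.1.natDegree else 0

variable {K}

open Classical in
-- Division by P ^ k is a bijection onto the rough polynomials of the complementary degree; a prime
-- of degree at most z divides no rough polynomial.
theorem card_filter_pow_dvd (P : PrimePoly K) {k : ℕ} (hk : 1 ≤ k) (m z : ℕ) :
    ((rough K m z).filter (P.1 ^ k ∣ ·)).card =
      if z < P.1.natDegree ∧ k * P.1.natDegree ≤ m then
        (rough K (m - k * P.1.natDegree) z).card else 0 := by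
  split_ifs with h
  · have hPk : P.1 ^ k ∈ rough K (k * P.1.natDegree) z := by
      rw [mem_rough]
      refine ⟨P.2.1.pow k, natDegree_pow _ _, fun Q hQ => ?_⟩
      have := eq_of_monic_of_associated Q.2.1 P.2.1
        ((Q.2.2.dvd_irreducible_iff_associated P.2.2).1 (Q.prime.dvd_of_dvd_pow hQ))
      rw [this]
      exact h.1
    symm
    refine Finset.card_bij (fun G _ => P.1 ^ k * G) (fun G hG => ?_) (fun G _ H _ hGH => ?_)
      (fun F hF => ?_)
    · rw [Finset.mem_filter]
      refine ⟨?_, dvd_mul_right _ _⟩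
      have := rough_mul hPk hG
      rwa [Nat.add_sub_of_le h.2] at this
    · exact mul_left_cancel₀ (pow_ne_zero _ P.prime.ne_zero) hGH
    · rw [Finset.mem_filter] at hF
      obtain ⟨hF, G, rfl⟩ := hF
      have hG : G.Monic := (P.2.1.pow k).of_mul_monic_left (mem_rough.1 hF).1
      have hd := (mem_rough.1 hF).2.1
      rw [(P.2.1.pow k).natDegree_mul hG, natDegree_pow] at hd
      have := rough_of_dvd hF hG (dvd_mul_left _ _)
      refine ⟨G, ?_, rfl⟩
      rwa [← hd, Nat.add_sub_cancel_left]
  · rw [Finset.card_eq_zero]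
    refine Finset.filter_eq_empty_iff.2 fun F hF hPF => h ?_
    rw [mem_rough] at hF
    refine ⟨hF.2.2 P ((dvd_pow_self _ (by omega)).trans hPF), ?_⟩
    rw [← hF.2.1, ← natDegree_pow]
    exact natDegree_le_of_dvd hPF hF.1.ne_zero

/-- The analogue of log = Λ * 1: sum deg F = Σ_{P^k ∣ F} deg P over all rough F and collect the
terms by j = deg P^k. -/
theorem mul_card_rough {M m z : ℕ} (hm : m ≤ M) :
    m * (rough K m z).card =
      ∑ j ∈ Finset.Icc 1 m, mangoldtSum K M z j * (rough K (m - j) z).card := by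
  classical
  have h1 : ∀ F ∈ rough K m z, m = ∑ P ∈ primesLE K M, ∑ k ∈ Finset.Icc 1 M,
      if P.1 ^ k ∣ F then P.1.natDegree else 0 := by
    intro F hF
    have hF' := mem_rough.1 hF
    have := sum_multiplicity_mul_natDegree hF'.1 (hF'.2.1.trans_le hm)
    rw [hF'.2.1] at this
    conv_lhs => rw [← this]
    refine Finset.sum_congr rfl fun P _ => ?_
    have hfin := P.finiteMultiplicity hF'.1.ne_zero
    rw [← Finset.sum_filter, Finset.sum_const, smul_eq_mul]
    congr 1
    have hle : multiplicity P.1 F ≤ M := by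
      have h2 := natDegree_le_of_dvd (pow_multiplicity_dvd P.1 F) hF'.1.ne_zero
      rw [natDegree_pow, hF'.2.1] at h2
      exact (Nat.le_mul_of_pos_right _ P.natDegree_pos).trans (h2.trans hm)
    have : (Finset.Icc 1 M).filter (fun k => P.1 ^ k ∣ F) =
        Finset.Icc 1 (multiplicity P.1 F) := by
      ext k
      simp only [Finset.mem_filter, Finset.mem_Icc, hfin.pow_dvd_iff_le_multiplicity]
      omega
    rw [this, Nat.card_Icc, Nat.add_sub_cancel]
  calc m * (rough K m z).card = ∑ F ∈ rough K m z, m := by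
        rw [Finset.sum_const, smul_eq_mul, mul_comm]
    _ = ∑ F ∈ rough K m z, ∑ P ∈ primesLE K M, ∑ k ∈ Finset.Icc 1 M,
          if P.1 ^ k ∣ F then P.1.natDegree else 0 := Finset.sum_congr rfl h1
    _ = ∑ P ∈ primesLE K M, ∑ k ∈ Finset.Icc 1 M, ∑ F ∈ rough K m z,
          if P.1 ^ k ∣ F then P.1.natDegree else 0 := by
        rw [Finset.sum_comm]
        exact Finset.sum_congr rfl fun P _ => Finset.sum_comm
    _ = ∑ P ∈ primesLE K M, ∑ k ∈ Finset.Icc 1 M, ∑ j ∈ Finset.Icc 1 m,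
          (if z < P.1.natDegree ∧ k * P.1.natDegree = j then P.1.natDegree else 0) *
            (rough K (m - j) z).card := by
        refine Finset.sum_congr rfl fun P _ => Finset.sum_congr rfl fun k hk => ?_
        rw [← Finset.sum_filter, Finset.sum_const, smul_eq_mul,
          card_filter_pow_dvd P (Finset.mem_Icc.1 hk).1]
        have hpos : 1 ≤ k * P.1.natDegree := Nat.mul_pos (Finset.mem_Icc.1 hk).1 P.natDegree_pos
        by_cases hz : z < P.1.natDegree
        · simp only [hz, true_and, ite_mul, zero_mul, Finset.sum_ite_eq, Finset.mem_Icc, hpos]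
          split_ifs <;> ring
        · simp [hz]
    _ = _ := by
        simp only [mangoldtSum, Finset.sum_mul]
        rw [Finset.sum_comm (s := Finset.Icc 1 m)]
        exact Finset.sum_congr rfl fun P _ => Finset.sum_comm

/-- For z = 0 the counts q^m are known, so the recursion can be solved for the prime-power sums:
each j < m contributes q^m, which leaves q^m for j = m. This is the exact prime polynomial theorem.
-/
theorem mangoldtSum_zero {M j : ℕ} (hj : 1 ≤ j) (hM : j ≤ M) :
    mangoldtSum K M 0 j = Nat.card K ^ j := by
  have hq : 1 ≤ Nat.card K := Nat.card_pos
  induction j using Nat.strong_induction_on with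
  | _ j ih =>
    have h := mul_card_rough (K := K) (z := 0) hM
    simp only [card_rough_zero] at h
    obtain ⟨i, rfl⟩ : ∃ i, j = i + 1 := ⟨j - 1, by omega⟩
    rw [Finset.sum_Icc_succ_top (by omega), Nat.sub_self, pow_zero, mul_one,
      Finset.sum_congr rfl (g := fun _ => Nat.card K ^ (i + 1)), Finset.sum_const, Nat.card_Icc,
      smul_eq_mul, Nat.add_sub_cancel, add_mul, one_mul] at h
    · omega
    · intro x hx
      rw [Finset.mem_Icc] at hx
      rw [ih x (by omega) hx.1 (by omega), ← pow_add]
      congr 1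
      omega

theorem mangoldtSum_le {M z j : ℕ} (hj : 1 ≤ j) (hM : j ≤ M) :
    mangoldtSum K M z j ≤ Nat.card K ^ j := by
  rw [← mangoldtSum_zero hj hM]
  refine Finset.sum_le_sum fun P _ => Finset.sum_le_sum fun k _ => ?_
  by_cases h : z < P.1.natDegree ∧ k * P.1.natDegree = j
  · rw [if_pos h, if_pos ⟨by omega, h.2⟩]
  · rw [if_neg h]
    exact Nat.zero_le _

theorem mangoldtSum_eq_zero {M z j : ℕ} (h : j ≤ z) : mangoldtSum K M z j = 0 := by
  refine Finset.sum_eq_zero fun P _ => Finset.sum_eq_zero fun k hk => if_neg ?_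
  rintro ⟨h1, rfl⟩
  have := Nat.le_mul_of_pos_left P.1.natDegree (Finset.mem_Icc.1 hk).1
  omega

/-- Compared with z = 0, only powers P^k with deg P ≤ z < j are lost. These have k ≥ 2, hence deg P
≤ j / 2, and such primes are covered by the full sums of degree d ≤ j / 2. -/
theorem le_mangoldtSum {M z j : ℕ} (hz : z < j) (hM : j ≤ M) :
    Nat.card K ^ j ≤ mangoldtSum K M z j + ∑ d ∈ Finset.Icc 1 (j / 2), Nat.card K ^ d := by
  classical
  rw [← mangoldtSum_zero (by omega) hM]
  have h1 : ∀ P ∈ primesLE K M, (∑ k ∈ Finset.Icc 1 M,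
      if 0 < P.1.natDegree ∧ k * P.1.natDegree = j then P.1.natDegree else 0) ≤
      (∑ k ∈ Finset.Icc 1 M,
        if z < P.1.natDegree ∧ k * P.1.natDegree = j then P.1.natDegree else 0) +
      if P.1.natDegree ≤ j / 2 then P.1.natDegree else 0 := by
    intro P _
    have hP := P.natDegree_pos
    by_cases hzP : z < P.1.natDegree
    · simp [hP, hzP]
    · refine le_add_left ?_
      by_cases hdvd : P.1.natDegree ∣ j
      · obtain ⟨c, rfl⟩ := hdvd
        have hc : 2 ≤ c := by
          by_contra! hc
          interval_cases c <;> omega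
        rw [if_pos]
        · have : ∀ k, (0 < P.1.natDegree ∧ k * P.1.natDegree = P.1.natDegree * c) ↔ k = c := by
            intro k
            rw [mul_comm, Nat.mul_left_cancel_iff hP]
            exact and_iff_right hP
          simp only [this, Finset.sum_ite_eq']
          split_ifs <;> omega
        · rw [Nat.le_div_iff_mul_le (by norm_num)]
          exact Nat.mul_le_mul_left _ hc
      · rw [Finset.sum_eq_zero]
        · exact Nat.zero_le _
        · intro k _
          rw [if_neg]
          rintro ⟨-, h⟩
          exact hdvd ⟨k, by rw [← h, mul_comm]⟩
  refine (Finset.sum_le_sum h1).trans ?_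
  rw [Finset.sum_add_distrib]
  refine Nat.add_le_add_left ?_ _
  calc ∑ P ∈ primesLE K M, (if P.1.natDegree ≤ j / 2 then P.1.natDegree else 0)
      ≤ ∑ P ∈ primesLE K M, ∑ d ∈ Finset.Icc 1 (j / 2), ∑ k ∈ Finset.Icc 1 M,
          if 0 < P.1.natDegree ∧ k * P.1.natDegree = d then P.1.natDegree else 0 := by
        refine Finset.sum_le_sum fun P _ => ?_
        have hP := P.natDegree_pos
        split_ifs with h
        · calc P.1.natDegree = (if 0 < P.1.natDegree ∧ 1 * P.1.natDegree = P.1.natDegree then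
                P.1.natDegree else 0) := by simp
            _ ≤ ∑ k ∈ Finset.Icc 1 M, if 0 < P.1.natDegree ∧ k * P.1.natDegree = P.1.natDegree
                then P.1.natDegree else 0 :=
              Finset.single_le_sum (f := fun k => if 0 < P.1.natDegree ∧
                k * P.1.natDegree = P.1.natDegree then P.1.natDegree else 0)
                (fun _ _ => Nat.zero_le _) (Finset.mem_Icc.2 (by omega))
            _ ≤ _ := Finset.single_le_sum (f := fun d => ∑ k ∈ Finset.Icc 1 M,
                if 0 < P.1.natDegree ∧ k * P.1.natDegree = d then P.1.natDegree else 0)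
                (fun _ _ => Nat.zero_le _) (Finset.mem_Icc.2 (by omega))
        · exact Nat.zero_le _
    _ = ∑ d ∈ Finset.Icc 1 (j / 2), mangoldtSum K M 0 d := Finset.sum_comm
    _ ≤ _ := Finset.sum_le_sum fun d hd => by
        rw [Finset.mem_Icc] at hd
        exact mangoldtSum_le hd.1 (by omega)

theorem sum_Icc_pow_le {q : ℕ} (hq : 2 ≤ q) (n : ℕ) : ∑ d ∈ Finset.Icc 1 n, q ^ d ≤ 2 * q ^ n := by
  induction n with
  | zero => simp
  | succ n ih =>
    rw [Finset.sum_Icc_succ_top (by omega)]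
    have : 2 * q ^ n ≤ q ^ (n + 1) := by rw [pow_succ, mul_comm]; exact Nat.mul_le_mul_left _ hq
    omega

end Counting

/-! ### Upper and lower bounds for the number of rough polynomials -/

section Bounds

variable {K : Type*} [Field K] [Finite K]

theorem two_le_card : 2 ≤ Nat.card K := Finite.one_lt_card

/-- Induction through the recursion: after multiplication by z, the m - 1 - z terms with z < j < m
give at most q^m each and j = m gives at most z q^m, in total (m - 1) q^m. -/
theorem mul_card_rough_le (z : ℕ) {m : ℕ} (hm : 1 ≤ m) :
    z * (rough K m z).card ≤ Nat.card K ^ m := by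
  induction m using Nat.strong_induction_on with
  | _ m ih =>
    rcases Nat.lt_or_ge z m with hzm | hzm
    swap
    · rw [rough_eq_empty hm hzm]
      simp
    have h := mul_card_rough (K := K) (z := z) (le_refl m)
    obtain ⟨i, rfl⟩ : ∃ i, m = i + 1 := ⟨m - 1, by omega⟩
    refine Nat.le_of_mul_le_mul_left ?_ hm
    have h1 : ∀ j ∈ Finset.Icc 1 i,
        z * (mangoldtSum K (i + 1) z j * (rough K (i + 1 - j) z).card) ≤
          if z < j then Nat.card K ^ (i + 1) else 0 := by
      intro j hj
      rw [Finset.mem_Icc] at hj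
      split_ifs with hzj
      · calc z * (mangoldtSum K (i + 1) z j * (rough K (i + 1 - j) z).card)
            = mangoldtSum K (i + 1) z j * (z * (rough K (i + 1 - j) z).card) := by ring
          _ ≤ Nat.card K ^ j * Nat.card K ^ (i + 1 - j) :=
            Nat.mul_le_mul (mangoldtSum_le hj.1 (by omega)) (ih _ (by omega) (by omega))
          _ = _ := by rw [← pow_add]; congr 1; omega
      · rw [mangoldtSum_eq_zero (by omega)]
        simp
    have h2 : ((Finset.Icc 1 i).filter (z < ·)).card = i - z := by
      have : (Finset.Icc 1 i).filter (z < ·) = Finset.Ioc z i := by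
        ext j
        simp only [Finset.mem_filter, Finset.mem_Icc, Finset.mem_Ioc]
        omega
      rw [this, Nat.card_Ioc]
    calc (i + 1) * (z * (rough K (i + 1) z).card)
        = z * ((i + 1) * (rough K (i + 1) z).card) := by ring
      _ ≤ (i - z) * Nat.card K ^ (i + 1) + z * Nat.card K ^ (i + 1) := by
        rw [h, Finset.sum_Icc_succ_top (by omega), Nat.sub_self, rough_zero_left,
          Finset.card_singleton, mul_one, mul_add, Finset.mul_sum]
        refine Nat.add_le_add ?_ (Nat.mul_le_mul_left _ (mangoldtSum_le hm le_rfl))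
        refine (Finset.sum_le_sum h1).trans ?_
        rw [← Finset.sum_filter, Finset.sum_const, h2, smul_eq_mul]
      _ = i * Nat.card K ^ (i + 1) := by rw [← add_mul]; congr 1; omega
      _ ≤ _ := Nat.mul_le_mul_right _ (Nat.le_succ i)

/-- The condition on z gives 4z ≤ q^(j - j/2), so the loss 2 q^(j/2) is at most q^j / (2z). -/
theorem le_mangoldtSum_real {M z j : ℕ} (hz4 : 4 * z ≤ 2 ^ (z / 2)) (hz : z < j) (hM : j ≤ M) :
    (2 * z - 1 : ℝ) * (Nat.card K : ℝ) ^ j ≤ 2 * z * mangoldtSum K M z j := by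
  have h1 := le_mangoldtSum (K := K) hz hM
  have h2 := sum_Icc_pow_le (two_le_card (K := K)) (j / 2)
  have h3 : 4 * z * Nat.card K ^ (j / 2) ≤ Nat.card K ^ j := by
    calc 4 * z * Nat.card K ^ (j / 2) ≤ Nat.card K ^ (j - j / 2) * Nat.card K ^ (j / 2) := by
          refine Nat.mul_le_mul_right _ (hz4.trans ?_)
          refine (Nat.pow_le_pow_left (two_le_card (K := K)) _).trans ?_
          exact Nat.pow_le_pow_right (by have := two_le_card (K := K); omega) (by omega)
      _ = _ := by rw [← pow_add]; congr 1; omega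
  have h4 : (Nat.card K : ℝ) ^ j ≤ mangoldtSum K M z j + 2 * (Nat.card K : ℝ) ^ (j / 2) := by
    exact_mod_cast h1.trans (Nat.add_le_add_left h2 _)
  have h5 : 4 * (z : ℝ) * (Nat.card K : ℝ) ^ (j / 2) ≤ (Nat.card K : ℝ) ^ j := by
    exact_mod_cast h3
  have h6 := mul_le_mul_of_nonneg_left h4 (by positivity : (0 : ℝ) ≤ 2 * z)
  linarith

/-- In the recursion only j = m and z < j < m - z are kept; for the latter m - j > z, so induction
applies. The factors 1 - 1/(2z) lost on the way are absorbed by the constant 4 as long as m ≤ z². -/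
theorem pow_le_mul_card_rough {z m : ℕ} (hz2 : 2 ≤ z) (hz4 : 4 * z ≤ 2 ^ (z / 2))
    (hzm : z < m) (hmz : m ≤ z ^ 2) :
    (Nat.card K : ℝ) ^ m ≤ 4 * z * (rough K m z).card := by
  induction m using Nat.strong_induction_on with
  | _ m ih =>
    have h := mul_card_rough (K := K) (z := z) (le_refl m)
    set q : ℝ := (Nat.card K : ℝ) with hq
    have hq0 : 0 < q := by
      have := two_le_card (K := K)
      rw [hq]
      positivity
    have hzR : (2 : ℝ) ≤ z := by exact_mod_cast hz2
    have hmR : (z : ℝ) < m := by exact_mod_cast hzm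
    have hm0 : (0 : ℝ) < m := by linarith
    have hmzR : (m : ℝ) ≤ (z : ℝ) ^ 2 := by exact_mod_cast hmz
    have hsub : insert m (Finset.Ioo z (m - z)) ⊆ Finset.Icc 1 m := by
      intro j
      simp only [Finset.mem_insert, Finset.mem_Ioo, Finset.mem_Icc]
      omega
    have h1 : mangoldtSum K m z m + ∑ j ∈ Finset.Ioo z (m - z),
        mangoldtSum K m z j * (rough K (m - j) z).card ≤ m * (rough K m z).card := by
      rw [h]
      refine le_trans (le_of_eq ?_) (Finset.sum_le_sum_of_subset hsub)
      rw [Finset.sum_insert (by simp), Nat.sub_self, rough_zero_left,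
        Finset.card_singleton, mul_one]
    have h1R : (mangoldtSum K m z m : ℝ) + ∑ j ∈ Finset.Ioo z (m - z),
        (mangoldtSum K m z j : ℝ) * (rough K (m - j) z).card ≤ m * (rough K m z).card := by
      exact_mod_cast h1
    have h2 : ∀ j ∈ Finset.Ioo z (m - z), (2 * z - 1 : ℝ) * q ^ m ≤
        8 * z ^ 2 * ((mangoldtSum K m z j : ℝ) * (rough K (m - j) z).card) := by
      intro j hj
      rw [Finset.mem_Ioo] at hj
      have e1 := le_mangoldtSum_real (K := K) hz4 hj.1 (by omega : j ≤ m)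
      have e2 := ih (m - j) (by omega) (by omega) (by omega)
      calc (2 * z - 1 : ℝ) * q ^ m = ((2 * z - 1 : ℝ) * q ^ j) * q ^ (m - j) := by
            rw [mul_assoc, ← pow_add]; congr 3; omega
        _ ≤ (2 * z * mangoldtSum K m z j) * (4 * z * (rough K (m - j) z).card) := by
            gcongr
        _ = _ := by ring
    have h3 := Finset.sum_le_sum h2
    rw [Finset.sum_const, Nat.card_Ioo, nsmul_eq_mul, ← Finset.mul_sum] at h3
    have h4 := le_mangoldtSum_real (K := K) hz4 hzm (le_refl m)
    rw [← hq] at h4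
    have hcard : (m : ℝ) - 2 * z - 1 ≤ ((m - z - z - 1 : ℕ) : ℝ) := by
      have : m ≤ (m - z - z - 1) + 2 * z + 1 := by omega
      have : (m : ℝ) ≤ ((m - z - z - 1 : ℕ) : ℝ) + 2 * z + 1 := by exact_mod_cast this
      linarith
    have hcard0 : (0 : ℝ) ≤ ((m - z - z - 1 : ℕ) : ℝ) := Nat.cast_nonneg _
    set c : ℝ := ((m - z - z - 1 : ℕ) : ℝ)
    have hQ : 0 < q ^ m := by positivity
    set Q := q ^ m
    have h5 : (4 * z * (2 * z - 1) + c * (2 * z - 1)) * Q ≤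
        8 * z ^ 2 * (m * (rough K m z).card) := by
      have := mul_le_mul_of_nonneg_left h1R (by positivity : (0 : ℝ) ≤ 8 * z ^ 2)
      have := mul_le_mul_of_nonneg_left h4 (by positivity : (0 : ℝ) ≤ 4 * z)
      linarith
    -- This closes the induction. For m > 2z + 1, inserting c ≥ m - 2z - 1 reduces it to m ≤ (2z -
    -- 1)², which follows from m ≤ z².
    have h6 : 2 * z * (m : ℝ) ≤ 4 * z * (2 * z - 1) + c * (2 * z - 1) := by
      rcases le_or_gt (m : ℝ) (2 * z + 1) with hm | hm
      · nlinarith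
      · have : (m - 2 * z - 1 : ℝ) * (2 * z - 1) ≤ c * (2 * z - 1) :=
          mul_le_mul_of_nonneg_right hcard (by linarith)
        nlinarith
    have h7 := (mul_le_mul_of_nonneg_right h6 hQ.le).trans h5
    refine le_of_mul_le_mul_left (a := 2 * z * (m : ℝ)) ?_ (by positivity)
    linarith

theorem eventually_four_mul_le : ∀ᶠ z : ℕ in atTop, 4 * z ≤ 2 ^ (z / 2) := by
  have h : ∀ k : ℕ, 6 ≤ k → 4 * (2 * k + 1) ≤ 2 ^ k := by
    intro k hk
    induction k, hk using Nat.le_induction with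
    | base => norm_num
    | succ k hk ih => rw [pow_succ]; omega
  filter_upwards [eventually_ge_atTop 12] with z hz
  refine le_trans ?_ (h (z / 2) (by omega))
  omega

end Bounds

/-! ### Integration by parts along measure-preserving rotations -/

section Stein

variable {X : Type*} [MeasurableSpace X] {ν : Measure X}

theorem integral_comp_of_measurePreserving {R : X → X} (hR : MeasurePreserving R ν ν) {H : X → ℂ}
    (hH : Measurable H) : ∫ x, H (R x) ∂ν = ∫ x, H x ∂ν := by
  conv_rhs => rw [← hR.map_eq]
  rw [integral_map hR.measurable.aemeasurable hH.aestronglyMeasurable]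

theorem integral_eq_zero_of_eigen {R : X → X} (hR : MeasurePreserving R ν ν) {H : X → ℂ}
    (hH : Measurable H) {ζ : ℂ} (hζ : ζ ≠ 1) (h : ∀ x, H (R x) = ζ * H x) :
    ∫ x, H x ∂ν = 0 := by
  have h1 := integral_comp_of_measurePreserving hR hH
  simp_rw [h, integral_const_mul] at h1
  have h2 : (ζ - 1) * ∫ x, H x ∂ν = 0 := by rw [sub_mul, h1, one_mul, sub_self]
  exact (mul_eq_zero.1 h2).resolve_left (sub_ne_zero.2 hζ)

/-- The derivative of a bounded function along a measure-preserving flow has integral zero. -/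
theorem integral_flow_deriv_eq_zero [IsProbabilityMeasure ν] {R : ℝ → X → X} (hR : ∀ s, MeasurePreserving (R s) ν ν)
    {H H' : X → ℂ} (hH : Measurable H) (hH' : Measurable H') {C : ℝ}
    (hC : ∀ x, ‖H x‖ ≤ C) (hC' : ∀ x, ‖H' x‖ ≤ C)
    (hd : ∀ x s, HasDerivAt (fun s => H (R s x)) (H' (R s x)) s) :
    ∫ x, H' x ∂ν = 0 := by
  have h := (hasDerivAt_integral_of_dominated_loc_of_deriv_le (μ := ν)
    (F := fun s x => H (R s x)) (F' := fun s x => H' (R s x)) (x₀ := 0) (bound := fun _ => C)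
    (s := Set.univ) Filter.univ_mem
    (Eventually.of_forall fun s => (hH.comp (hR s).measurable).aestronglyMeasurable)
    (Integrable.of_bound (hH.comp (hR 0).measurable).aestronglyMeasurable C
      (Eventually.of_forall fun x => hC _))
    (hH'.comp (hR 0).measurable).aestronglyMeasurable
    (Eventually.of_forall fun x s _ => hC' _) (integrable_const C)
    (Eventually.of_forall fun x s _ => hd x s)).2
  -- By invariance the integral does not depend on s, so its derivative vanishes.
  simp_rw [fun s => integral_comp_of_measurePreserving (hR s) hH,
    integral_comp_of_measurePreserving (hR 0) hH'] at h
  exact h.unique (hasDerivAt_const _ _)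

/-- Unimodular functions `χ F` which are multiplied by `exp (i s v P F)` under the measure-preserving
rotation `R P s`. -/
structure IsRotated {τ κ : Type*} (ν : Measure X) (χ : κ → X → ℂ) (v : τ → κ → ℕ)
    (R : τ → ℝ → X → X) : Prop where
  measurable : ∀ F, Measurable (χ F)
  norm : ∀ F x, ‖χ F x‖ = 1
  preserving : ∀ P s, MeasurePreserving (R P s) ν ν
  rotate : ∀ P s F x, χ F (R P s x) = Complex.exp (v P F * s * Complex.I) * χ F x

variable {τ κ : Type*} {χ : κ → X → ℂ} {v : τ → κ → ℕ} {R : τ → ℝ → X → X}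

theorem IsRotated.hasDerivAt (h : IsRotated ν χ v R) (P : τ) (F : κ) (x : X) (s : ℝ) :
    HasDerivAt (fun s => χ F (R P s x)) (Complex.I * v P F * χ F (R P s x)) s := by
  simp_rw [h.rotate]
  have h1 : HasDerivAt (fun s : ℝ => (v P F * s * Complex.I : ℂ)) (v P F * Complex.I) s := by
    simpa using ((Complex.ofRealCLM.hasDerivAt (x := s)).const_mul (v P F : ℂ)).mul_const Complex.I
  exact (h1.cexp.mul_const (χ F x)).congr_deriv (by ring)

/-- The sum of the characters that involve `P`. -/
noncomputable def partSum (χ : κ → X → ℂ) (v : τ → κ → ℕ) (A : Finset κ) (P : τ) (x : X) : ℂ :=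
  ∑ F ∈ A, (if 0 < v P F then 1 else 0) * χ F x

/-- The sum of the characters weighted by their exponent at `P`. -/
noncomputable def derivSum (χ : κ → X → ℂ) (v : τ → κ → ℕ) (A : Finset κ) (P : τ) (x : X) : ℂ :=
  ∑ F ∈ A, v P F * χ F x

/-- The carré du champ of `S` and its conjugate, for `S = a ∑ χ F`. -/
noncomputable def gammaConj (χ : κ → X → ℂ) (v : τ → κ → ℕ) (T : Finset τ) (A : Finset κ)
    (c : τ → ℝ) (a : ℝ) (x : X) : ℂ :=
  a ^ 2 * ∑ P ∈ T, c P * (partSum χ v A P x * starRingEnd ℂ (derivSum χ v A P x))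

/-- The carré du champ of `S` and itself, for `S = a ∑ χ F`. -/
noncomputable def gammaSelf (χ : κ → X → ℂ) (v : τ → κ → ℕ) (T : Finset τ) (A : Finset κ)
    (c : τ → ℝ) (a : ℝ) (x : X) : ℂ :=
  a ^ 2 * ∑ P ∈ T, c P * (partSum χ v A P x * derivSum χ v A P x)

/-- The total error in Stein's method. -/
noncomputable def steinError (ν : Measure X) (χ : κ → X → ℂ) (v : τ → κ → ℕ) (T : Finset τ)
    (A : Finset κ) (c : τ → ℝ) (a : ℝ) : ℝ :=
  ∫ x, ‖gammaConj χ v T A c a x - 1‖ ∂ν + ∫ x, ‖gammaSelf χ v T A c a x‖ ∂ν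

/-- The exponential `exp (i Re (t̄ S))`. -/
noncomputable def expRe (S : X → ℂ) (t : ℂ) (x : X) : ℂ :=
  Complex.exp ((starRingEnd ℂ t * S x).re * Complex.I)

omit [MeasurableSpace X] in
theorem norm_expRe (S : X → ℂ) (t : ℂ) (x : X) : ‖expRe S t x‖ = 1 :=
  Complex.norm_exp_ofReal_mul_I _

theorem measurable_expRe {S : X → ℂ} (hS : Measurable S) (t : ℂ) : Measurable (expRe S t) := by
  unfold expRe
  fun_prop

theorem IsRotated.measurable_partSum (h : IsRotated ν χ v R) (A : Finset κ) (P : τ) :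
    Measurable (partSum χ v A P) :=
  Finset.measurable_fun_sum _ fun F _ => (h.measurable F).const_mul _

theorem IsRotated.measurable_derivSum (h : IsRotated ν χ v R) (A : Finset κ) (P : τ) :
    Measurable (derivSum χ v A P) :=
  Finset.measurable_fun_sum _ fun F _ => (h.measurable F).const_mul _

theorem IsRotated.norm_partSum_le (h : IsRotated ν χ v R) (A : Finset κ) (P : τ) (x : X) :
    ‖partSum χ v A P x‖ ≤ A.card := by
  refine (norm_sum_le _ _).trans ?_
  rw [Finset.card_eq_sum_ones, Nat.cast_sum]
  refine Finset.sum_le_sum fun F _ => ?_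
  rw [norm_mul, h.norm, mul_one]
  split_ifs <;> simp

theorem IsRotated.norm_derivSum_le (h : IsRotated ν χ v R) (A : Finset κ) (P : τ) (x : X) :
    ‖derivSum χ v A P x‖ ≤ ∑ F ∈ A, (v P F : ℝ) := by
  refine (norm_sum_le _ _).trans (le_of_eq ?_)
  refine Finset.sum_congr rfl fun F _ => ?_
  rw [norm_mul, h.norm, mul_one]
  simp

/-- The P-derivative of p e integrates to zero, where p is `partSum` and e the exponential. The
derivative of p is i D, with D the `derivSum`, because characters not involving P do not move;
differentiating e gives the right-hand side. -/
theorem IsRotated.integral_derivSum_mul_exp [IsProbabilityMeasure ν] (h : IsRotated ν χ v R) (A : Finset κ) (P : τ)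
    (a : ℝ) (t : ℂ) :
    ∫ x, derivSum χ v A P x * expRe (fun x => a * ∑ F ∈ A, χ F x) t x ∂ν =
      Complex.I * t * a / 2 * ∫ x, partSum χ v A P x * starRingEnd ℂ (derivSum χ v A P x) *
          expRe (fun x => a * ∑ F ∈ A, χ F x) t x ∂ν
      - Complex.I * starRingEnd ℂ t * a / 2 * ∫ x, partSum χ v A P x * derivSum χ v A P x *
          expRe (fun x => a * ∑ F ∈ A, χ F x) t x ∂ν := by
  set S : X → ℂ := fun x => a * ∑ F ∈ A, χ F x with hS
  set p := partSum χ v A P with hp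
  set D := derivSum χ v A P with hD
  have hSm : Measurable S :=
    (Finset.measurable_fun_sum _ fun F _ => h.measurable F).const_mul _
  have hpm : Measurable p := h.measurable_partSum A P
  have hDm : Measurable D := h.measurable_derivSum A P
  have hem : Measurable (expRe S t) := measurable_expRe hSm t
  set H' : X → ℂ := fun x => Complex.I * (D x * expRe S t x) +
    (p x * expRe S t x) * ((starRingEnd ℂ t * (Complex.I * a * D x)).re * Complex.I) with hH'
  have hpd : ∀ x s, HasDerivAt (fun s => p (R P s x)) (Complex.I * D (R P s x)) s := by
    intro x s
    have := HasDerivAt.fun_sum (u := A) (fun F _ => (h.hasDerivAt P F x s).const_mul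
      ((if 0 < v P F then 1 else 0 : ℂ)))
    refine this.congr_deriv ?_
    rw [hD, derivSum, Finset.mul_sum]
    refine Finset.sum_congr rfl fun F _ => ?_
    split_ifs with hv
    · ring
    · rw [Nat.eq_zero_of_not_pos hv]; simp
  have hSd : ∀ x s, HasDerivAt (fun s => S (R P s x)) (Complex.I * a * D (R P s x)) s := by
    intro x s
    have := (HasDerivAt.fun_sum (u := A) (fun F _ => (h.hasDerivAt P F x s))).const_mul (a : ℂ)
    refine this.congr_deriv ?_
    rw [hD, derivSum, Finset.mul_sum, Finset.mul_sum]
    exact Finset.sum_congr rfl fun F _ => by ring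
  have hed : ∀ x s, HasDerivAt (fun s => expRe S t (R P s x)) (expRe S t (R P s x) *
      ((starRingEnd ℂ t * (Complex.I * a * D (R P s x))).re * Complex.I)) s := by
    intro x s
    have h1 := Complex.reCLM.hasFDerivAt.comp_hasDerivAt s
      ((hSd x s).const_mul (starRingEnd ℂ t))
    exact (h1.ofReal_comp.mul_const Complex.I).cexp
  have hpb := h.norm_partSum_le A P
  have hDb := h.norm_derivSum_le A P
  have hint : ∫ x, H' x ∂ν = 0 := by
    set d : ℝ := ∑ F ∈ A, (v P F : ℝ)
    have hd0 : 0 ≤ d := Finset.sum_nonneg fun _ _ => Nat.cast_nonneg _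
    refine integral_flow_deriv_eq_zero (R := R P) (H := fun x => p x * expRe S t x)
      (C := A.card + d + A.card * (‖t‖ * (|a| * d))) (h.preserving P) (hpm.mul hem) ?_ ?_ ?_ ?_
    · fun_prop
    · intro x
      rw [norm_mul, norm_expRe, mul_one]
      have : 0 ≤ A.card * (‖t‖ * (|a| * d)) := by positivity
      linarith [hpb x]
    · intro x
      refine (norm_add_le _ _).trans ?_
      have e1 : ‖Complex.I * (D x * expRe S t x)‖ ≤ d := by
        rw [norm_mul, norm_mul, norm_expRe, Complex.norm_I, mul_one, one_mul]
        exact hDb x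
      have e2 : ‖(p x * expRe S t x) *
          ((starRingEnd ℂ t * (Complex.I * a * D x)).re * Complex.I)‖ ≤
          A.card * (‖t‖ * (|a| * d)) := by
        rw [norm_mul, norm_mul, norm_expRe, mul_one, norm_mul, Complex.norm_I, mul_one,
          Complex.norm_real, Real.norm_eq_abs]
        refine mul_le_mul (hpb x) ((Complex.abs_re_le_norm _).trans ?_) (abs_nonneg _)
          (Nat.cast_nonneg _)
        rw [norm_mul, norm_mul, norm_mul, Complex.norm_I, one_mul, RCLike.norm_conj,
          Complex.norm_real, Real.norm_eq_abs]
        gcongr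
        exact hDb x
      have : (0 : ℝ) ≤ A.card := Nat.cast_nonneg _
      linarith
    · intro x s
      refine ((hpd x s).mul (hed x s)).congr_deriv ?_
      rw [hH']
      ring
  -- Writing the real part as half the sum with the conjugate separates the D̄ term, with factor t,
  -- from the D term, with factor t̄.
  have hre : ∀ x, (((starRingEnd ℂ t * (Complex.I * a * D x)).re : ℝ) : ℂ) =
      a / 2 * (Complex.I * starRingEnd ℂ t * D x - Complex.I * t * starRingEnd ℂ (D x)) := by
    intro x
    rw [Complex.re_eq_add_conj]
    simp only [map_mul, Complex.conj_conj, Complex.conj_I, Complex.conj_ofReal]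
    ring
  have hI : ∀ {u : X → ℂ}, Measurable u → ∀ C : ℝ, (∀ x, ‖u x‖ ≤ C) →
      Integrable (fun x => u x * expRe S t x) ν := by
    intro u hu C hC
    refine Integrable.of_bound (hu.mul hem).aestronglyMeasurable C (Eventually.of_forall fun x => ?_)
    rw [norm_mul, norm_expRe, mul_one]
    exact hC x
  have hpDb : ∀ x, ‖p x * D x‖ ≤ A.card * ∑ F ∈ A, (v P F : ℝ) := fun x => by
    rw [norm_mul]
    exact mul_le_mul (hpb x) (hDb x) (norm_nonneg _) (Nat.cast_nonneg _)
  have i1 := hI hDm _ hDb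
  have i2 := hI (hpm.mul hDm) _ hpDb
  have i3 := hI (u := fun x => p x * starRingEnd ℂ (D x))
    (hpm.mul (Complex.continuous_conj.measurable.comp hDm)) _
    (fun x => by simpa [norm_mul, RCLike.norm_conj] using hpDb x)
  have hH'' : ∀ x, H' x = Complex.I * (D x * expRe S t x)
      - (starRingEnd ℂ t * a / 2) * (p x * D x * expRe S t x)
      + (t * a / 2) * (p x * starRingEnd ℂ (D x) * expRe S t x) := by
    intro x
    rw [hH']
    simp only [hre]
    linear_combination (p x * expRe S t x * a / 2 * (starRingEnd ℂ t * D x -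
      t * starRingEnd ℂ (D x))) * Complex.I_mul_I
  simp_rw [hH''] at hint
  rw [integral_add, integral_sub, integral_const_mul, integral_const_mul,
    integral_const_mul] at hint
  · linear_combination (-Complex.I) * hint + (∫ x, D x * expRe S t x ∂ν) * Complex.I_mul_I
  · exact i1.const_mul _
  · exact i2.const_mul _
  · exact (i1.const_mul _).sub (i2.const_mul _)
  · exact i3.const_mul _

end Stein

/-! ### From the Stein identity to the characteristic function -/

section SteinBound

variable {X : Type*} [MeasurableSpace X] {ν : Measure X} [IsProbabilityMeasure ν]
variable {τ κ : Type*} {χ : κ → X → ℂ} {v : τ → κ → ℕ} {R : τ → ℝ → X → X}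

omit [IsProbabilityMeasure ν] in
theorem integrable_mul_expRe {u S : X → ℂ} (hu : Integrable u ν) (hS : Measurable S) (t : ℂ) :
    Integrable (fun x => u x * expRe S t x) ν :=
  hu.mul_bdd (c := 1) (measurable_expRe hS t).aestronglyMeasurable
    (Eventually.of_forall fun x => (norm_expRe S t x).le)

theorem IsRotated.integrable_derivSum (h : IsRotated ν χ v R) (A : Finset κ) (P : τ) :
    Integrable (derivSum χ v A P) ν :=
  Integrable.of_bound (h.measurable_derivSum A P).aestronglyMeasurable _
    (Eventually.of_forall (h.norm_derivSum_le A P))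

theorem IsRotated.integrable_partSum_mul_derivSum (h : IsRotated ν χ v R) (A : Finset κ) (P : τ) :
    Integrable (fun x => partSum χ v A P x * derivSum χ v A P x) ν :=
  (h.integrable_derivSum A P).bdd_mul (c := (A.card : ℝ))
    (h.measurable_partSum A P).aestronglyMeasurable
    (Eventually.of_forall (h.norm_partSum_le A P))

theorem IsRotated.integrable_partSum_mul_conj (h : IsRotated ν χ v R) (A : Finset κ) (P : τ) :
    Integrable (fun x => partSum χ v A P x * starRingEnd ℂ (derivSum χ v A P x)) ν := by
  refine (h.integrable_partSum_mul_derivSum A P).mono ?_ (Eventually.of_forall fun x => ?_)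
  · exact ((h.measurable_partSum A P).mul
      (Complex.continuous_conj.measurable.comp (h.measurable_derivSum A P))).aestronglyMeasurable
  · simp

theorem IsRotated.integrable_gammaConj (h : IsRotated ν χ v R) (T : Finset τ) (A : Finset κ)
    (c : τ → ℝ) (a : ℝ) : Integrable (gammaConj χ v T A c a) ν :=
  (integrable_finsetSum _ fun P _ => (h.integrable_partSum_mul_conj A P).const_mul _).const_mul _

omit [IsProbabilityMeasure ν] in
theorem IsRotated.measurable_sum (h : IsRotated ν χ v R) (A : Finset κ) (a : ℝ) :
    Measurable (fun x => (a : ℂ) * ∑ F ∈ A, χ F x) :=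
  (Finset.measurable_fun_sum _ fun F _ => h.measurable F).const_mul _

theorem IsRotated.integrable_sum (h : IsRotated ν χ v R) (A : Finset κ) (a : ℝ) :
    Integrable (fun x => (a : ℂ) * ∑ F ∈ A, χ F x) ν :=
  (integrable_finsetSum _ fun F _ => Integrable.of_bound (h.measurable F).aestronglyMeasurable 1
    (Eventually.of_forall fun x => (h.norm F x).le)).const_mul _

/-- The hypothesis on c says that Σ χ_F is the c-weighted sum of the `derivSum`s, so the identities
for single primes add up. -/
theorem IsRotated.integral_sum_mul_exp (h : IsRotated ν χ v R) {T : Finset τ} {A : Finset κ}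
    {c : τ → ℝ} (hc : ∀ F ∈ A, ∑ P ∈ T, c P * v P F = 1) (a : ℝ) (t : ℂ) :
    ∫ x, (a * ∑ F ∈ A, χ F x) * expRe (fun x => a * ∑ F ∈ A, χ F x) t x ∂ν =
      Complex.I * t / 2 * ∫ x, gammaConj χ v T A c a x *
          expRe (fun x => a * ∑ F ∈ A, χ F x) t x ∂ν
      - Complex.I * starRingEnd ℂ t / 2 * ∫ x, gammaSelf χ v T A c a x *
          expRe (fun x => a * ∑ F ∈ A, χ F x) t x ∂ν := by
  have hSm := h.measurable_sum A a
  set S : X → ℂ := fun x => a * ∑ F ∈ A, χ F x with hS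
  have e1 : ∀ x, (a * ∑ F ∈ A, χ F x) * expRe S t x =
      ∑ P ∈ T, a * c P * (derivSum χ v A P x * expRe S t x) := by
    intro x
    have : ∑ F ∈ A, χ F x = ∑ P ∈ T, c P * derivSum χ v A P x := by
      simp only [derivSum, Finset.mul_sum]
      rw [Finset.sum_comm]
      refine Finset.sum_congr rfl fun F hF => ?_
      have := congrArg (fun r : ℝ => (r : ℂ)) (hc F hF)
      push_cast at this
      conv_lhs => rw [← one_mul (χ F x), ← this, Finset.sum_mul]
      exact Finset.sum_congr rfl fun P _ => by ring
    rw [this, Finset.mul_sum, Finset.sum_mul]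
    exact Finset.sum_congr rfl fun P _ => by ring
  have e2 : ∀ x, gammaConj χ v T A c a x * expRe S t x = ∑ P ∈ T, a ^ 2 * c P *
      (partSum χ v A P x * starRingEnd ℂ (derivSum χ v A P x) * expRe S t x) := by
    intro x
    rw [gammaConj, Finset.mul_sum, Finset.sum_mul]
    exact Finset.sum_congr rfl fun P _ => by ring
  have e3 : ∀ x, gammaSelf χ v T A c a x * expRe S t x = ∑ P ∈ T, a ^ 2 * c P *
      (partSum χ v A P x * derivSum χ v A P x * expRe S t x) := by
    intro x
    rw [gammaSelf, Finset.mul_sum, Finset.sum_mul]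
    exact Finset.sum_congr rfl fun P _ => by ring
  simp_rw [e1, e2, e3]
  rw [integral_finsetSum, integral_finsetSum, integral_finsetSum, Finset.mul_sum,
    Finset.mul_sum, ← Finset.sum_sub_distrib]
  · refine Finset.sum_congr rfl fun P _ => ?_
    rw [integral_const_mul, integral_const_mul, integral_const_mul,
      h.integral_derivSum_mul_exp A P a t]
    ring
  · exact fun P _ => (integrable_mul_expRe (h.integrable_partSum_mul_derivSum A P) hSm t).const_mul _
  · exact fun P _ => (integrable_mul_expRe (h.integrable_partSum_mul_conj A P) hSm t).const_mul _
  · exact fun P _ => (integrable_mul_expRe (h.integrable_derivSum A P) hSm t).const_mul _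

theorem IsRotated.norm_integral_sum_mul_exp_sub_le (h : IsRotated ν χ v R) {T : Finset τ}
    {A : Finset κ} {c : τ → ℝ} (hc : ∀ F ∈ A, ∑ P ∈ T, c P * v P F = 1) (a : ℝ) (t : ℂ) :
    ‖∫ x, (a * ∑ F ∈ A, χ F x) * expRe (fun x => a * ∑ F ∈ A, χ F x) t x ∂ν -
      Complex.I * t / 2 * ∫ x, expRe (fun x => a * ∑ F ∈ A, χ F x) t x ∂ν‖ ≤
      ‖t‖ / 2 * steinError ν χ v T A c a := by
  have hSm := h.measurable_sum A a
  rw [h.integral_sum_mul_exp hc]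
  set S : X → ℂ := fun x => a * ∑ F ∈ A, χ F x with hS
  have hG := h.integrable_gammaConj T A c a
  have he : Integrable (expRe S t) ν := by
    simpa using integrable_mul_expRe (integrable_const (1 : ℂ)) hSm t
  have e1 : ∫ x, (gammaConj χ v T A c a x - 1) * expRe S t x ∂ν =
      ∫ x, gammaConj χ v T A c a x * expRe S t x ∂ν - ∫ x, expRe S t x ∂ν := by
    simp_rw [sub_mul, one_mul]
    exact integral_sub (integrable_mul_expRe hG hSm t) he
  have b : ∀ u : X → ℂ, ‖∫ x, u x * expRe S t x ∂ν‖ ≤ ∫ x, ‖u x‖ ∂ν := by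
    intro u
    refine (norm_integral_le_integral_norm _).trans (le_of_eq ?_)
    simp_rw [norm_mul, norm_expRe, mul_one]
  have e2 : ∀ G E G' : ℂ, Complex.I * t / 2 * G - Complex.I * starRingEnd ℂ t / 2 * G' -
      Complex.I * t / 2 * E = Complex.I * t / 2 * (G - E) -
      Complex.I * starRingEnd ℂ t / 2 * G' := fun _ _ _ => by ring
  rw [e2, ← e1, steinError, mul_add]
  refine (norm_sub_le _ _).trans (add_le_add ?_ ?_)
  · rw [norm_mul, norm_div, norm_mul, Complex.norm_I, one_mul, Complex.norm_two]
    exact mul_le_mul_of_nonneg_left (b _) (by positivity)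
  · rw [norm_mul, norm_div, norm_mul, Complex.norm_I, one_mul, Complex.norm_two, RCLike.norm_conj]
    exact mul_le_mul_of_nonneg_left (b _) (by positivity)

/-- Stein's method: the characteristic function of a normalized sum of characters is close to that
of the standard complex normal law. -/
theorem IsRotated.norm_integral_expRe_sub_le (h : IsRotated ν χ v R) {T : Finset τ}
    {A : Finset κ} {c : τ → ℝ} (hc : ∀ F ∈ A, ∑ P ∈ T, c P * v P F = 1) (a : ℝ) (t : ℂ) :
    ‖∫ x, expRe (fun x => a * ∑ F ∈ A, χ F x) t x ∂ν - Complex.exp (-(‖t‖ ^ 2 / 4 : ℝ))‖ ≤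
      ‖t‖ ^ 2 / 2 * Real.exp (‖t‖ ^ 2 / 4) * steinError ν χ v T A c a := by
  have hSm := h.measurable_sum A a
  have hSi := h.integrable_sum A a
  have hbound := h.norm_integral_sum_mul_exp_sub_le hc a
  set S : X → ℂ := fun x => a * ∑ F ∈ A, χ F x with hS
  set η := steinError ν χ v T A c a with hη
  have hη0 : 0 ≤ η := add_nonneg (integral_nonneg fun _ => norm_nonneg _)
    (integral_nonneg fun _ => norm_nonneg _)
  set φ : ℝ → ℂ := fun r => ∫ x, expRe S (r * t) x ∂ν with hφ
  have hneg : ∀ (u : ℂ) x, expRe S (-u) x = starRingEnd ℂ (expRe S u x) := by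
    intro u x
    rw [expRe, expRe, ← Complex.exp_conj]
    congr 1
    rw [map_mul, Complex.conj_ofReal, Complex.conj_I, map_neg, neg_mul, Complex.neg_re]
    push_cast
    ring
  have hconj : ∀ u : ℂ, ∫ x, starRingEnd ℂ (S x) * expRe S u x ∂ν =
      starRingEnd ℂ (∫ x, S x * expRe S (-u) x ∂ν) := by
    intro u
    rw [← integral_conj]
    simp [hneg]
  -- The estimate for S̄ at u is the conjugate of the estimate for S at -u.
  have hbound' : ∀ u : ℂ, ‖∫ x, starRingEnd ℂ (S x) * expRe S u x ∂ν -
      Complex.I * starRingEnd ℂ u / 2 * ∫ x, expRe S u x ∂ν‖ ≤ ‖u‖ / 2 * η := by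
    intro u
    have h1 := hbound (-u)
    rw [norm_neg, ← RCLike.norm_conj (K := ℂ), map_sub] at h1
    have h2 : starRingEnd ℂ (Complex.I * -u / 2 * ∫ x, expRe S (-u) x ∂ν) =
        Complex.I * starRingEnd ℂ u / 2 * ∫ x, expRe S u x ∂ν := by
      simp_rw [hneg, integral_conj]
      simp only [map_mul, map_div₀, Complex.conj_I, map_neg, Complex.conj_conj, map_ofNat]
      ring
    rwa [h2, ← hconj u] at h1
  have hφd : ∀ r : ℝ, HasDerivAt φ (∫ x, expRe S (r * t) x *
      ((starRingEnd ℂ t * S x).re * Complex.I) ∂ν) r := by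
    intro r
    refine (hasDerivAt_integral_of_dominated_loc_of_deriv_le (μ := ν)
      (F := fun r x => expRe S ((r : ℝ) * t) x) (F' := fun r x => expRe S ((r : ℝ) * t) x *
        ((starRingEnd ℂ t * S x).re * Complex.I)) (x₀ := r) (bound := fun x => ‖t‖ * ‖S x‖)
      (s := Set.univ) Filter.univ_mem (Eventually.of_forall fun s =>
        (measurable_expRe hSm _).aestronglyMeasurable) ?_ ?_ ?_ ?_ ?_).2
    · simpa using integrable_mul_expRe (integrable_const (1 : ℂ)) hSm _
    · have := measurable_expRe hSm (r * t)
      fun_prop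
    · refine Eventually.of_forall fun x s _ => ?_
      rw [norm_mul, norm_expRe, one_mul, norm_mul, Complex.norm_I, mul_one, Complex.norm_real]
      refine (Complex.abs_re_le_norm _).trans (le_of_eq ?_)
      rw [norm_mul, RCLike.norm_conj]
    · exact hSi.norm.const_mul _
    · refine Eventually.of_forall fun x s _ => ?_
      have e : ∀ s : ℝ, expRe S (s * t) x =
          Complex.exp (s * ((starRingEnd ℂ t * S x).re * Complex.I)) := by
        intro s
        rw [expRe, map_mul, Complex.conj_ofReal, mul_assoc, Complex.re_ofReal_mul]
        push_cast
        ring_nf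
      simp_rw [e]
      simpa using ((Complex.ofRealCLM.hasDerivAt (x := s)).mul_const
        ((starRingEnd ℂ t * S x).re * Complex.I : ℂ)).cexp
  have hφ' : ∀ r : ℝ, ∫ x, expRe S (r * t) x * ((starRingEnd ℂ t * S x).re * Complex.I) ∂ν =
      Complex.I / 2 * (starRingEnd ℂ t * ∫ x, S x * expRe S (r * t) x ∂ν +
        t * ∫ x, starRingEnd ℂ (S x) * expRe S (r * t) x ∂ν) := by
    intro r
    have i1 := integrable_mul_expRe hSi hSm (r * t)
    have i2 : Integrable (fun x => starRingEnd ℂ (S x) * expRe S (r * t) x) ν := by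
      refine integrable_mul_expRe (hSi.mono ?_ (Eventually.of_forall fun x => ?_)) hSm _
      · exact (Complex.continuous_conj.measurable.comp hSm).aestronglyMeasurable
      · rw [RCLike.norm_conj]
    rw [← integral_const_mul, ← integral_const_mul, ← integral_add (i1.const_mul _)
      (i2.const_mul _), ← integral_const_mul]
    refine integral_congr_ae (Eventually.of_forall fun x => ?_)
    simp only
    rw [Complex.re_eq_add_conj, map_mul, Complex.conj_conj]
    ring
  -- Integrating factor: g would be constant if φ' = -(r‖t‖²/2) φ held exactly, so only the Stein
  -- error enters its derivative.
  set g : ℝ → ℂ := fun r => φ r * Complex.exp ((r ^ 2 * (‖t‖ ^ 2 / 4) : ℝ)) with hg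
  have hgd : ∀ r : ℝ, HasDerivAt g ((∫ x, expRe S (r * t) x *
      ((starRingEnd ℂ t * S x).re * Complex.I) ∂ν + r * ‖t‖ ^ 2 / 2 * φ r) *
      Complex.exp ((r ^ 2 * (‖t‖ ^ 2 / 4) : ℝ))) r := by
    intro r
    have h1 : HasDerivAt (fun r : ℝ => r ^ 2 * (‖t‖ ^ 2 / 4)) (2 * r * (‖t‖ ^ 2 / 4)) r := by
      simpa using (hasDerivAt_pow 2 r).mul_const (‖t‖ ^ 2 / 4)
    refine ((hφd r).mul h1.ofReal_comp.cexp).congr_deriv ?_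
    push_cast
    ring
  have hgb : ∀ r ∈ Set.Ico (0 : ℝ) 1, ‖(∫ x, expRe S (r * t) x *
      ((starRingEnd ℂ t * S x).re * Complex.I) ∂ν + r * ‖t‖ ^ 2 / 2 * φ r) *
      Complex.exp ((r ^ 2 * (‖t‖ ^ 2 / 4) : ℝ))‖ ≤
      ‖t‖ ^ 2 / 2 * Real.exp (‖t‖ ^ 2 / 4) * η := by
    intro r hr
    rw [hφ' r, norm_mul, ← Complex.ofReal_exp, Complex.norm_real, Real.norm_eq_abs,
      abs_of_pos (Real.exp_pos _)]
    have hn : ‖(r * t : ℂ)‖ ≤ ‖t‖ := by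
      rw [norm_mul, Complex.norm_real, Real.norm_eq_abs, abs_of_nonneg hr.1]
      exact mul_le_of_le_one_left (norm_nonneg _) hr.2.le
    have b1 := (hbound (r * t)).trans
      (mul_le_mul_of_nonneg_right (div_le_div_of_nonneg_right hn zero_le_two) hη0)
    have b2 := (hbound' (r * t)).trans
      (mul_le_mul_of_nonneg_right (div_le_div_of_nonneg_right hn zero_le_two) hη0)
    have htt : starRingEnd ℂ t * t = (‖t‖ : ℂ) ^ 2 := Complex.conj_mul' t
    -- Each of the two subtracted main terms accounts for r‖t‖²φ/4, which together is the term added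
    -- on the left.
    have e : Complex.I / 2 * (starRingEnd ℂ t * ∫ x, S x * expRe S (r * t) x ∂ν +
        t * ∫ x, starRingEnd ℂ (S x) * expRe S (r * t) x ∂ν) + r * ‖t‖ ^ 2 / 2 * φ r =
        Complex.I / 2 * (starRingEnd ℂ t * (∫ x, S x * expRe S (r * t) x ∂ν -
          Complex.I * (r * t) / 2 * φ r) + t * (∫ x, starRingEnd ℂ (S x) * expRe S (r * t) x ∂ν -
          Complex.I * starRingEnd ℂ (r * t) / 2 * φ r)) := by
      rw [← htt, map_mul, Complex.conj_ofReal]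
      linear_combination (starRingEnd ℂ t * t * r / 2 * φ r) * Complex.I_mul_I
    rw [e]
    have b3 : ‖Complex.I / 2 * (starRingEnd ℂ t * (∫ x, S x * expRe S (r * t) x ∂ν -
          Complex.I * (r * t) / 2 * φ r) + t * (∫ x, starRingEnd ℂ (S x) * expRe S (r * t) x ∂ν -
          Complex.I * starRingEnd ℂ (r * t) / 2 * φ r))‖ ≤ ‖t‖ ^ 2 / 2 * η := by
      rw [norm_mul, norm_div, Complex.norm_I, Complex.norm_two]
      refine (mul_le_mul_of_nonneg_left (norm_add_le _ _) (by norm_num)).trans ?_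
      rw [norm_mul, norm_mul, RCLike.norm_conj]
      have := mul_le_mul_of_nonneg_left b1 (norm_nonneg t)
      have := mul_le_mul_of_nonneg_left b2 (norm_nonneg t)
      linarith
    calc _ ≤ ‖t‖ ^ 2 / 2 * η * Real.exp (‖t‖ ^ 2 / 4) := by
          refine mul_le_mul b3 (Real.exp_le_exp.2 ?_) (Real.exp_pos _).le (by positivity)
          refine mul_le_of_le_one_left (by positivity) ?_
          exact pow_le_one₀ hr.1 hr.2.le
      _ = _ := by ring
  have hfin := norm_image_sub_le_of_norm_deriv_le_segment_01'
    (fun r _ => (hgd r).hasDerivWithinAt) hgb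
  have g0 : g 0 = 1 := by simp [hg, hφ, expRe]
  have g1 : g 1 = φ 1 * Complex.exp ((‖t‖ ^ 2 / 4 : ℝ)) := by simp [hg]
  have hφ1 : φ 1 = ∫ x, expRe S t x ∂ν := by simp [hφ]
  have hfac : φ 1 - Complex.exp (-(‖t‖ ^ 2 / 4 : ℝ)) =
      (g 1 - g 0) * Complex.exp (-(‖t‖ ^ 2 / 4 : ℝ)) := by
    rw [g0, g1, sub_mul, mul_assoc, ← Complex.exp_add, add_neg_cancel, Complex.exp_zero, mul_one,
      one_mul]
  rw [← hφ1, hfac, norm_mul]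
  refine (mul_le_of_le_one_right (norm_nonneg _) ?_).trans hfin
  rw [← Complex.ofReal_neg, ← Complex.ofReal_exp, Complex.norm_real, Real.norm_eq_abs,
    abs_of_pos (Real.exp_pos _), Real.exp_le_one_iff]
  exact neg_nonpos.2 (by positivity)

end SteinBound

/-! ### Realization on the torus and the Gaussian characteristic function -/

section Torus

variable {K : Type*} [Field K] [Finite K]

instance : Countable (PrimePoly K) := by
  refine Set.countable_univ_iff.1 ((Set.countable_iUnion fun M =>
    (finite_primePoly_natDegree_le (K := K) M).countable).mono fun P _ => ?_)
  exact Set.mem_iUnion.2 ⟨P.1.natDegree, le_refl P.1.natDegree⟩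

instance : IsProbabilityMeasure (volume : Measure UnitAddCircle) := ⟨UnitAddCircle.measure_univ⟩

theorem measurable_toCircle :
    Measurable fun y : UnitAddCircle => (AddCircle.toCircle y : ℂ) :=
  (continuous_subtype_val.comp AddCircle.continuous_toCircle).measurable

variable (K) in
/-- The Haar probability measure on the product of circles indexed by the primes. -/
noncomputable def torusMeasure : Measure (PrimePoly K → UnitAddCircle) :=
  Measure.infinitePi fun _ => volume

instance : IsProbabilityMeasure (torusMeasure K) := by
  unfold torusMeasure
  infer_instance

/-- The exponent of `P` in `F`, truncated at the primes of degree at most `N`. -/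
noncomputable def expo (N : ℕ) (P : PrimePoly K) (F : K[X]) : ℕ :=
  if P.1.natDegree ≤ N then multiplicity P.1 F else 0

/-- The character of the torus attached to `F`, as a polynomial of degree at most `N`. -/
noncomputable def torusChar (N : ℕ) (F : K[X]) (x : PrimePoly K → UnitAddCircle) : ℂ :=
  ∏ P ∈ primesLE K N, (AddCircle.toCircle (x P) : ℂ) ^ multiplicity P.1 F

open Classical in
/-- Rotation of the coordinate at `P` by the angle `s`. -/
noncomputable def rotateAt (P : PrimePoly K) (s : ℝ) (x : PrimePoly K → UnitAddCircle) :
    PrimePoly K → UnitAddCircle :=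
  fun Q => x Q + if Q = P then ((s / (2 * Real.pi) : ℝ) : UnitAddCircle) else 0

omit [Finite K] in
theorem measurePreserving_rotateAt (P : PrimePoly K) (s : ℝ) :
    MeasurePreserving (rotateAt P s) (torusMeasure K) (torusMeasure K) := by
  classical
  have h : ∀ Q : PrimePoly K, MeasurePreserving (fun y : UnitAddCircle => y +
      if Q = P then ((s / (2 * Real.pi) : ℝ) : UnitAddCircle) else 0) volume volume :=
    fun Q => measurePreserving_add_right _ _
  refine ⟨measurable_pi_lambda _ fun Q => (h Q).measurable.comp (measurable_pi_apply Q), ?_⟩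
  have := Measure.infinitePi_map_pi (μ := fun _ : PrimePoly K => (volume : Measure UnitAddCircle))
    (fun Q => (h Q).measurable)
  simp_rw [fun Q => (h Q).map_eq] at this
  exact this

theorem isRotated_torusChar (N : ℕ) :
    IsRotated (torusMeasure K) (torusChar N) (expo N) rotateAt where
  measurable F := by
    refine Finset.measurable_fun_prod _ fun P _ => Measurable.pow_const ?_ _
    exact measurable_toCircle.comp (measurable_pi_apply P)
  norm F x := by
    rw [torusChar, norm_prod]
    exact Finset.prod_eq_one fun P _ => by rw [norm_pow, Circle.norm_coe, one_pow]
  preserving := measurePreserving_rotateAt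
  rotate P s F x := by
    classical
    have h : ∀ Q ∈ primesLE K N, (AddCircle.toCircle (rotateAt P s x Q) : ℂ) ^ multiplicity Q.1 F =
        (if Q = P then Complex.exp (multiplicity P.1 F * s * Complex.I) else 1) *
          (AddCircle.toCircle (x Q) : ℂ) ^ multiplicity Q.1 F := by
      intro Q _
      rw [rotateAt]
      split_ifs with hQ
      · subst hQ
        rw [AddCircle.toCircle_add, Circle.coe_mul, mul_pow, mul_comm]
        congr 1
        rw [AddCircle.toCircle_apply_mk, Circle.coe_exp, ← Complex.exp_nat_mul]
        congr 1
        -- `UnitAddCircle` has period 1, so rotation by the angle s is translation by s / (2π).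
        have : (2 * Real.pi / 1 * (s / (2 * Real.pi)) : ℝ) = s := by
          field_simp
        rw [this]
        ring
      · rw [add_zero, one_mul]
    rw [torusChar, torusChar, Finset.prod_congr rfl h, Finset.prod_mul_distrib,
      Finset.prod_ite_eq']
    simp only [mem_primesLE, expo]
    split_ifs <;> simp

omit [Finite K] in
-- The truncation in `expo` matches the finite product in `torusChar`, so that the rotation rule
-- holds for every F; it is invisible in degree at most N.
theorem expo_eq {N : ℕ} {F : K[X]} (hF : F.Monic) (hN : F.natDegree ≤ N) (P : PrimePoly K) :
    expo N P F = multiplicity P.1 F := by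
  rw [expo]
  split_ifs with h
  · rfl
  · by_contra h0
    have := natDegree_le_of_dvd
      ((multiplicity_pos_iff_dvd hF P).1 (by omega)) hF.ne_zero
    omega

variable (K) in
/-- The weights `deg P / N`. -/
noncomputable def primeWeight (N : ℕ) (P : PrimePoly K) : ℝ := P.1.natDegree / N

omit [Finite K] in
theorem primeWeight_nonneg (N : ℕ) (P : PrimePoly K) : 0 ≤ primeWeight K N P := by
  unfold primeWeight
  positivity

/-- Degree is additive and all of A has degree N, so one choice of weights normalizes every F at
once. -/
theorem sum_weight_mul_expo {N z : ℕ} (hN : 1 ≤ N) {F : K[X]} (hF : F ∈ rough K N z) :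
    ∑ P ∈ primesLE K N, primeWeight K N P * expo N P F = 1 := by
  rw [mem_rough] at hF
  have h := sum_multiplicity_mul_natDegree hF.1 hF.2.1.le
  rw [hF.2.1] at h
  have hN0 : (N : ℝ) ≠ 0 := by positivity
  have h' : ∑ P ∈ primesLE K N, (multiplicity P.1 F : ℝ) * P.1.natDegree = N := by
    exact_mod_cast h
  calc _ = ∑ P ∈ primesLE K N, (multiplicity P.1 F : ℝ) * P.1.natDegree / N := by
        refine Finset.sum_congr rfl fun P _ => ?_
        rw [expo_eq hF.1 hF.2.1.le, primeWeight]
        ring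
    _ = 1 := by rw [← Finset.sum_div, h', div_self hN0]

theorem map_toCircle_volume :
    (volume : Measure UnitAddCircle).map (fun y => (AddCircle.toCircle y : ℂ)) = uniformCircle := by
  have hm := measurable_toCircle
  have hp := UnitAddCircle.measurePreserving_mk 0
  rw [← hp.map_eq, Measure.map_map hm hp.measurable, uniformCircle, zero_add]
  congr 1
  ext θ
  simp only [Function.comp_apply]
  rw [AddCircle.toCircle_apply_mk, Circle.coe_exp]
  push_cast
  ring_nf

instance : IsProbabilityMeasure uniformCircle := by
  rw [← map_toCircle_volume]
  exact Measure.isProbabilityMeasure_map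
    measurable_toCircle.aemeasurable

/-- The normalized sum as a function of the values at the primes. -/
noncomputable def primeSum (K : Type*) [Field K] [Finite K] (N z : ℕ) (y : PrimePoly K → ℂ) : ℂ :=
  (1 / Real.sqrt ((rough K N z).card : ℝ) : ℝ) *
    ∑ F ∈ rough K N z, ∏ P ∈ primesLE K N, y P ^ multiplicity P.1 F

theorem measurable_primeSum (N z : ℕ) : Measurable (primeSum K N z) := by
  unfold primeSum
  fun_prop

variable {Ω : Type*} [MeasurableSpace Ω] {μ : Measure Ω} {f : K[X] → Ω → ℂ}

theorem IsSteinhaus.normalizedSum_eq (hf : IsSteinhaus μ f) (N z : ℕ) (ω : Ω) :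
    normalizedSum f (rough K N z) ω = primeSum K N z fun P => f P.1 ω := by
  rw [normalizedSum, primeSum]
  congr 1
  refine Finset.sum_congr rfl fun F hF => ?_
  rw [mem_rough] at hF
  have h := hf.map_prod ((primesLE K N).map (Function.Embedding.subtype _))
    (fun P => multiplicity P F) (fun P hP => by
      obtain ⟨Q, -, rfl⟩ := Finset.mem_map.1 hP
      exact Q.2) ω
  rw [Finset.prod_map, Finset.prod_map] at h
  have e := prod_pow_multiplicity hF.1 hF.2.1.le
  simp only [Function.Embedding.coe_subtype] at h
  rwa [e] at h

theorem IsSteinhaus.aemeasurable_pi (hf : IsSteinhaus μ f) :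
    AEMeasurable (fun ω (P : PrimePoly K) => f P.1 ω) μ :=
  aemeasurable_pi_iff.2 fun P => (hf.hasLaw P.1 P.2.1 P.2.2).aemeasurable

theorem IsSteinhaus.aemeasurable_normalizedSum (hf : IsSteinhaus μ f) (N z : ℕ) :
    AEMeasurable (normalizedSum f (rough K N z)) μ := by
  have := (measurable_primeSum (K := K) N z).comp_aemeasurable hf.aemeasurable_pi
  exact this.congr (Eventually.of_forall fun ω => (hf.normalizedSum_eq N z ω).symm)

/-- The law depends only on the joint law of the prime values, which independence makes a product.
An arbitrary Ω may thus be replaced by the torus, where rotations exist. -/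
theorem IsSteinhaus.map_normalizedSum [IsProbabilityMeasure μ] (hf : IsSteinhaus μ f) (N z : ℕ) :
    μ.map (normalizedSum f (rough K N z)) = (torusMeasure K).map (fun x =>
      ((1 / Real.sqrt ((rough K N z).card : ℝ) : ℝ) : ℂ) *
        ∑ F ∈ rough K N z, torusChar N F x) := by
  have hm := measurable_toCircle
  have h1 : normalizedSum f (rough K N z) =
      primeSum K N z ∘ fun ω (P : PrimePoly K) => f P.1 ω :=
    funext fun ω => hf.normalizedSum_eq N z ω
  have h2 := hf.indep.hasLaw_infinitePi (fun P : PrimePoly K => hf.hasLaw P.1 P.2.1 P.2.2) hf.aemeasurable_pi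
  have h3 := Measure.infinitePi_map_pi (μ := fun _ : PrimePoly K => (volume : Measure UnitAddCircle))
    (fun _ => hm)
  simp_rw [map_toCircle_volume] at h3
  have h4 : Measurable fun (x : PrimePoly K → UnitAddCircle) (P : PrimePoly K) =>
      (AddCircle.toCircle (x P) : ℂ) :=
    measurable_pi_lambda _ fun P => hm.comp (measurable_pi_apply P)
  rw [h1, ← AEMeasurable.map_map_of_aemeasurable (measurable_primeSum N z).aemeasurable
    hf.aemeasurable_pi, h2.map_eq, ← h3, Measure.map_map (measurable_primeSum N z) h4]
  rfl

theorem charFun_map_eq_integral_expRe {X : Type*} [MeasurableSpace X] {ν : Measure X} {S : X → ℂ}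
    (hS : Measurable S) (t : ℂ) : charFun (ν.map S) t = ∫ x, expRe S t x ∂ν := by
  rw [charFun_apply, integral_map hS.aemeasurable (by fun_prop)]
  refine integral_congr_ae (Eventually.of_forall fun x => ?_)
  simp only [expRe]
  rw [Complex.inner, ← Complex.conj_re, map_mul, Complex.conj_conj, mul_comm]

theorem charFun_stdComplexNormal (t : ℂ) :
    charFun stdComplexNormal t = Complex.exp (-(‖t‖ ^ 2 / 4 : ℝ)) := by
  rw [stdComplexNormal, charFun_map_eq_integral_expRe (by fun_prop)]
  have h : ∀ p : ℝ × ℝ, expRe (fun p : ℝ × ℝ => (p.1 : ℂ) + p.2 * Complex.I) t p =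
      Complex.exp (t.re * p.1 * Complex.I) * Complex.exp (t.im * p.2 * Complex.I) := by
    intro p
    rw [expRe, ← Complex.exp_add, ← add_mul]
    congr 2
    rw [← Complex.ofReal_mul, ← Complex.ofReal_mul, ← Complex.ofReal_add]
    simp
  simp_rw [h]
  rw [integral_prod_mul (fun x : ℝ => Complex.exp (t.re * x * Complex.I))
    (fun y : ℝ => Complex.exp (t.im * y * Complex.I)), ← charFun_apply_real, ← charFun_apply_real,
    charFun_gaussianReal, charFun_gaussianReal, ← Complex.exp_add]
  congr 1
  rw [← Complex.normSq_eq_norm_sq, Complex.normSq_apply]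
  push_cast
  ring

end Torus

/-! ### Counting multiplicative quadruples -/

section Energy

variable (K : Type*) [Field K] [Finite K]

/-- The number of nontrivial multiplicative quadruples in terms of the counts of rough
polynomials. -/
noncomputable def energyBound (N z : ℕ) : ℕ :=
  ∑ m ∈ Finset.Ioo 0 N, (rough K m z).card ^ 2 * (rough K (N - m) z).card ^ 2

open Classical in
/-- The image, under `g`, of the quadruples `(x, y, u, w)` with `x, y` of degree `m` and `u, w` of
degree `N - m`, for some `0 < m < N`. -/
noncomputable def splitImage {α : Type*} (g : (K[X] × K[X]) × (K[X] × K[X]) → α) (N z : ℕ) :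
    Finset α :=
  (Finset.Ioo 0 N).biUnion fun m =>
    ((rough K m z ×ˢ rough K m z) ×ˢ (rough K (N - m) z ×ˢ rough K (N - m) z)).image g

variable {K}

theorem card_splitImage_le {α : Type*} (g : (K[X] × K[X]) × (K[X] × K[X]) → α) (N z : ℕ) :
    (splitImage K g N z).card ≤ energyBound K N z := by
  classical
  refine Finset.card_biUnion_le.trans (Finset.sum_le_sum fun m _ => ?_)
  refine Finset.card_image_le.trans (le_of_eq ?_)
  simp only [Finset.card_product]
  ring

theorem mem_splitImage {α : Type*} {g : (K[X] × K[X]) × (K[X] × K[X]) → α} {N z m : ℕ}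
    {x y u w : K[X]} (hm : 0 < m) (hmN : m < N) (hx : x ∈ rough K m z) (hy : y ∈ rough K m z)
    (hu : u ∈ rough K (N - m) z) (hw : w ∈ rough K (N - m) z) :
    g ((x, y), (u, w)) ∈ splitImage K g N z := by
  classical
  refine Finset.mem_biUnion.2 ⟨m, Finset.mem_Ioo.2 ⟨hm, hmN⟩, Finset.mem_image_of_mem _ ?_⟩
  simp [hx, hy, hu, hw]

omit [Finite K] in
theorem exists_monic_factor {a b c : K[X]} (ha : a.Monic) (h : a ∣ b * c) :
    ∃ x u, x.Monic ∧ u.Monic ∧ x ∣ b ∧ u ∣ c ∧ a = x * u := by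
  obtain ⟨x, u, hx, hu, rfl⟩ := exists_dvd_and_dvd_of_dvd_mul h
  have h1 : x.leadingCoeff * u.leadingCoeff = 1 := by rw [← leadingCoeff_mul, ha.leadingCoeff]
  have hx0 : x.leadingCoeff ≠ 0 := left_ne_zero_of_mul_eq_one h1
  have hu0 : u.leadingCoeff ≠ 0 := right_ne_zero_of_mul_eq_one h1
  -- The leading coefficients are mutually inverse, so exchanging them makes both factors monic.
  refine ⟨C u.leadingCoeff * x, C x.leadingCoeff * u, ?_, ?_, ?_, ?_, ?_⟩
  · rw [Monic, leadingCoeff_mul, leadingCoeff_C, mul_comm, h1]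
  · rw [Monic, leadingCoeff_mul, leadingCoeff_C, h1]
  · exact (C_mul_dvd hu0).2 hx
  · exact (C_mul_dvd hx0).2 hu
  · calc x * u = C (x.leadingCoeff * u.leadingCoeff) * (x * u) := by rw [h1, C_1, one_mul]
      _ = _ := by rw [C_mul]; ring

/-- Since a ∣ c d, write a = x u with x ∣ c and u ∣ d; the cofactors w, y then give b = w y. Equal
degrees force deg x = deg y and deg u = deg w, and degree 0 for x or u gives the trivial solutions.
-/
theorem rough_quadruple {N z : ℕ} {a b c d : K[X]} (ha : a ∈ rough K N z) (hb : b ∈ rough K N z)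
    (hc : c ∈ rough K N z) (hd : d ∈ rough K N z) (h : a * b = c * d) :
    (a = c ∧ b = d) ∨ (a = d ∧ b = c) ∨ ∃ m, 0 < m ∧ m < N ∧ ∃ x ∈ rough K m z,
      ∃ y ∈ rough K m z, ∃ u ∈ rough K (N - m) z, ∃ w ∈ rough K (N - m) z,
      a = x * u ∧ b = w * y ∧ c = x * w ∧ d = u * y := by
  obtain ⟨x, u, hx, hu, ⟨w, rfl⟩, ⟨y, rfl⟩, rfl⟩ :=
    exists_monic_factor (mem_rough.1 ha).1 (Dvd.intro b h)
  have hb' : b = w * y := by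
    refine mul_left_cancel₀ (mul_ne_zero hx.ne_zero hu.ne_zero) (h.trans ?_)
    ring
  subst hb'
  have hw : w.Monic := hx.of_mul_monic_left (mem_rough.1 hc).1
  have hy : y.Monic := hu.of_mul_monic_left (mem_rough.1 hd).1
  have d1 := (mem_rough.1 ha).2.1
  have d2 := (mem_rough.1 hc).2.1
  have d3 := (mem_rough.1 hd).2.1
  rw [hx.natDegree_mul hu] at d1
  rw [hx.natDegree_mul hw] at d2
  rw [hu.natDegree_mul hy] at d3
  have rx := rough_of_dvd ha hx (dvd_mul_right _ _)
  have ru := rough_of_dvd ha hu (dvd_mul_left _ _)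
  have rw' := rough_of_dvd hc hw (dvd_mul_left _ _)
  have ry := rough_of_dvd hd hy (dvd_mul_left _ _)
  rcases Nat.eq_zero_or_pos x.natDegree with h0 | h0
  · have hx1 := hx.natDegree_eq_zero.1 h0
    have hy1 := hy.natDegree_eq_zero.1 (by omega)
    subst hx1 hy1
    simp
  rcases Nat.eq_zero_or_pos u.natDegree with h1 | h1
  · have hu1 := hu.natDegree_eq_zero.1 h1
    have hw1 := hw.natDegree_eq_zero.1 (by omega)
    subst hu1 hw1
    simp
  refine Or.inr (Or.inr ⟨x.natDegree, h0, by omega, x, rx, y, ?_, u, ?_, w, ?_, rfl, rfl, rfl, rfl⟩)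
  · rwa [show x.natDegree = y.natDegree by omega]
  · rwa [show N - x.natDegree = u.natDegree by omega]
  · rwa [show N - x.natDegree = w.natDegree by omega]

variable (K) in
open Classical in
/-- The pairs of rough polynomials of degree `N` with a common prime factor. -/
noncomputable def commonPairs (N z : ℕ) : Finset (K[X] × K[X]) :=
  (rough K N z ×ˢ rough K N z).filter fun p => ∃ P : PrimePoly K, P.1 ∣ p.1 ∧ P.1 ∣ p.2

theorem mem_commonPairs {N z : ℕ} {p : K[X] × K[X]} : p ∈ commonPairs K N z ↔
    (p.1 ∈ rough K N z ∧ p.2 ∈ rough K N z) ∧ ∃ P : PrimePoly K, P.1 ∣ p.1 ∧ P.1 ∣ p.2 := by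
  simp [commonPairs]

/-- A pair with common prime P is (Pu, Pw): equal entries if u = 1, otherwise the image of (P, P, u,
w). The repeated P fills an idle slot so that the same bound E serves. -/
theorem card_commonPairs_le (N z : ℕ) :
    (commonPairs K N z).card ≤ (rough K N z).card + energyBound K N z := by
  classical
  have hsub : commonPairs K N z ⊆ (rough K N z).image (fun F => (F, F)) ∪
      splitImage K (fun p => (p.1.1 * p.2.1, p.1.1 * p.2.2)) N z := by
    rintro ⟨F, G⟩ hp
    obtain ⟨⟨hF, hG⟩, P, ⟨u, hu⟩, ⟨w, hw⟩⟩ := mem_commonPairs.1 hp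
    simp only at hF hG hu hw
    subst hu hw
    have mu := P.2.1.of_mul_monic_left (mem_rough.1 hF).1
    have mw := P.2.1.of_mul_monic_left (mem_rough.1 hG).1
    have d1 := (mem_rough.1 hF).2.1
    have d2 := (mem_rough.1 hG).2.1
    rw [P.2.1.natDegree_mul mu] at d1
    rw [P.2.1.natDegree_mul mw] at d2
    have rP := rough_of_dvd hF P.2.1 (dvd_mul_right _ _)
    have ru := rough_of_dvd hF mu (dvd_mul_left _ _)
    have rw' := rough_of_dvd hG mw (dvd_mul_left _ _)
    rw [Finset.mem_union]
    rcases Nat.eq_zero_or_pos u.natDegree with h1 | h1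
    · left
      have hu1 := mu.natDegree_eq_zero.1 h1
      have hw1 := mw.natDegree_eq_zero.1 (by omega)
      subst hu1 hw1
      exact Finset.mem_image_of_mem _ hF
    · right
      refine mem_splitImage (g := fun p => (p.1.1 * p.2.1, p.1.1 * p.2.2)) (y := P.1)
        P.natDegree_pos (by omega) rP rP ?_ ?_
      · rwa [show N - P.1.natDegree = u.natDegree by omega]
      · rwa [show N - P.1.natDegree = w.natDegree by omega]
  refine (Finset.card_le_card hsub).trans ((Finset.card_union_le _ _).trans ?_)
  exact Nat.add_le_add Finset.card_image_le (card_splitImage_le _ _ _)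

open Classical in
-- Excluding F = G removes one kind of trivial solution; the other is determined by a single pair
-- with a common prime.
theorem card_ratio_quadruples_le (N z : ℕ) :
    (((commonPairs K N z).filter (fun p => p.1 ≠ p.2) ×ˢ
      (commonPairs K N z).filter (fun p => p.1 ≠ p.2)).filter
        (fun r => r.1.1 * r.2.2 = r.2.1 * r.1.2)).card ≤
      2 * (rough K N z).card + 3 * energyBound K N z := by
  have hsub : (((commonPairs K N z).filter (fun p => p.1 ≠ p.2) ×ˢ
      (commonPairs K N z).filter (fun p => p.1 ≠ p.2)).filter
        (fun r => r.1.1 * r.2.2 = r.2.1 * r.1.2)) ⊆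
      (commonPairs K N z).image (fun p => (p, p)) ∪
      splitImage K (fun p => ((p.1.1 * p.2.1, p.2.1 * p.1.2), (p.1.1 * p.2.2, p.2.2 * p.1.2)))
        N z := by
    rintro ⟨⟨F, G⟩, ⟨F', G'⟩⟩ hr
    simp only [Finset.mem_filter, Finset.mem_product] at hr
    obtain ⟨⟨⟨h1, h2⟩, ⟨h3, -⟩⟩, h⟩ := hr
    obtain ⟨⟨hF, hG⟩, -⟩ := mem_commonPairs.1 h1
    obtain ⟨⟨hF', hG'⟩, -⟩ := mem_commonPairs.1 h3
    rw [Finset.mem_union]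
    rcases rough_quadruple hF hG' hF' hG h with ⟨e1, e2⟩ | ⟨e1, -⟩ |
      ⟨m, hm, hmN, x, hx, y, hy, u, hu, w, hw, rfl, rfl, rfl, rfl⟩
    · left
      simp only at e1 e2
      subst e1 e2
      exact Finset.mem_image_of_mem _ h1
    · exact (h2 e1).elim
    · right
      exact mem_splitImage (g := fun p =>
        ((p.1.1 * p.2.1, p.2.1 * p.1.2), (p.1.1 * p.2.2, p.2.2 * p.1.2))) hm hmN hx hy hu hw
  refine (Finset.card_le_card hsub).trans ((Finset.card_union_le _ _).trans ?_)
  have h1 : ((commonPairs K N z).image (fun p => (p, p))).card ≤ (commonPairs K N z).card :=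
    Finset.card_image_le
  have h2 := card_commonPairs_le (K := K) N z
  have h3 := card_splitImage_le (K := K)
    (fun p => ((p.1.1 * p.2.1, p.2.1 * p.1.2), (p.1.1 * p.2.2, p.2.2 * p.1.2))) N z
  omega

open Classical in
-- Both trivial matchings survive here, which gives 2(|A| + E) + E; the bound for ratios is weakened
-- to the same expression.
theorem card_product_quadruples_le (N z : ℕ) :
    ((commonPairs K N z ×ˢ commonPairs K N z).filter
        (fun r => r.1.1 * r.1.2 = r.2.1 * r.2.2)).card ≤
      2 * (rough K N z).card + 3 * energyBound K N z := by
  have hsub : ((commonPairs K N z ×ˢ commonPairs K N z).filter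
        (fun r => r.1.1 * r.1.2 = r.2.1 * r.2.2)) ⊆
      ((commonPairs K N z).image (fun p => (p, p)) ∪
        (commonPairs K N z).image (fun p => (p, p.swap))) ∪
      splitImage K (fun p => ((p.1.1 * p.2.1, p.2.2 * p.1.2), (p.1.1 * p.2.2, p.2.1 * p.1.2)))
        N z := by
    rintro ⟨⟨F, G⟩, ⟨F', G'⟩⟩ hr
    simp only [Finset.mem_filter, Finset.mem_product] at hr
    obtain ⟨⟨h1, h3⟩, h⟩ := hr
    obtain ⟨⟨hF, hG⟩, -⟩ := mem_commonPairs.1 h1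
    obtain ⟨⟨hF', hG'⟩, -⟩ := mem_commonPairs.1 h3
    rw [Finset.mem_union, Finset.mem_union]
    rcases rough_quadruple hF hG hF' hG' h with ⟨e1, e2⟩ | ⟨e1, e2⟩ |
      ⟨m, hm, hmN, x, hx, y, hy, u, hu, w, hw, rfl, rfl, rfl, rfl⟩
    · simp only at e1 e2
      subst e1 e2
      exact Or.inl (Or.inl (Finset.mem_image_of_mem _ h1))
    · simp only at e1 e2
      subst e1 e2
      exact Or.inl (Or.inr (Finset.mem_image_of_mem (fun p : K[X] × K[X] => (p, p.swap)) h1))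
    · right
      exact mem_splitImage (g := fun p =>
        ((p.1.1 * p.2.1, p.2.2 * p.1.2), (p.1.1 * p.2.2, p.2.1 * p.1.2))) hm hmN hx hy hu hw
  refine (Finset.card_le_card hsub).trans ((Finset.card_union_le _ _).trans ?_)
  have h0 := Finset.card_union_le ((commonPairs K N z).image (fun p => (p, p)))
    ((commonPairs K N z).image (fun p => (p, p.swap)))
  have h1 : ((commonPairs K N z).image (fun p => (p, p))).card ≤ (commonPairs K N z).card :=
    Finset.card_image_le
  have h1' : ((commonPairs K N z).image (fun p => (p, p.swap))).card ≤ (commonPairs K N z).card :=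
    Finset.card_image_le
  have h2 := card_commonPairs_le (K := K) N z
  have h3 := card_splitImage_le (K := K)
    (fun p => ((p.1.1 * p.2.1, p.2.2 * p.1.2), (p.1.1 * p.2.2, p.2.1 * p.1.2))) N z
  omega

end Energy

/-! ### Second moments of weighted character sums -/

section SecondMoment

variable {X : Type*} [MeasurableSpace X] {ν : Measure X} [IsProbabilityMeasure ν]

theorem sq_integral_norm_le {u : X → ℂ} (hu : Integrable u ν)
    (hu2 : Integrable (fun x => ‖u x‖ ^ 2) ν) :
    (∫ x, ‖u x‖ ∂ν) ^ 2 ≤ ∫ x, ‖u x‖ ^ 2 ∂ν := by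
  set c := ∫ x, ‖u x‖ ∂ν with hc
  have h : ∫ x, 2 * c * ‖u x‖ ∂ν ≤ ∫ x, (c ^ 2 + ‖u x‖ ^ 2) ∂ν := by
    refine integral_mono (hu.norm.const_mul _) ((integrable_const _).add hu2) fun x => ?_
    simp only
    nlinarith [sq_nonneg (c - ‖u x‖)]
  rw [integral_const_mul, integral_add (integrable_const _) hu2, integral_const] at h
  simp only [probReal_univ, one_smul] at h
  nlinarith

open Classical in
-- The L¹ norm is at most the L² norm. In the expanded square only pairs marked by r can correlate,
-- and each contributes at most 1.
theorem integral_norm_sum_le {κ : Type*} (I : Finset κ) {w : κ → ℝ} (hw0 : ∀ i ∈ I, 0 ≤ w i)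
    (hw1 : ∀ i ∈ I, w i ≤ 1) {ψ : κ → X → ℂ} (hm : ∀ i, Measurable (ψ i))
    (hn : ∀ i x, ‖ψ i x‖ = 1) {r : κ × κ → Prop}
    (hr : ∀ i ∈ I, ∀ j ∈ I, ¬ r (i, j) → ∫ x, ψ i x * starRingEnd ℂ (ψ j x) ∂ν = 0) :
    ∫ x, ‖∑ i ∈ I, w i * ψ i x‖ ∂ν ≤ Real.sqrt (((I ×ˢ I).filter r).card) := by
  have hψ : ∀ i, Integrable (ψ i) ν := fun i =>
    Integrable.of_bound (hm i).aestronglyMeasurable 1 (Eventually.of_forall fun x => (hn i x).le)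
  have hψψ : ∀ i j, Integrable (fun x => ψ i x * starRingEnd ℂ (ψ j x)) ν := fun i j =>
    Integrable.of_bound ((hm i).mul
      (Complex.continuous_conj.measurable.comp (hm j))).aestronglyMeasurable 1
      (Eventually.of_forall fun x => by rw [norm_mul, RCLike.norm_conj, hn, hn, one_mul])
  have hs : Integrable (fun x => ∑ i ∈ I, w i * ψ i x) ν :=
    integrable_finsetSum _ fun i _ => (hψ i).const_mul _
  have he : ∀ x, ((‖∑ i ∈ I, w i * ψ i x‖ ^ 2 : ℝ) : ℂ) =
      ∑ p ∈ I ×ˢ I, (w p.1 * w p.2 : ℂ) * (ψ p.1 x * starRingEnd ℂ (ψ p.2 x)) := by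
    intro x
    rw [Complex.ofReal_pow, ← Complex.mul_conj', map_sum, Finset.sum_mul_sum, Finset.sum_product]
    refine Finset.sum_congr rfl fun i _ => Finset.sum_congr rfl fun j _ => ?_
    rw [map_mul, Complex.conj_ofReal]
    ring
  have hint : Integrable (fun x => ∑ p ∈ I ×ˢ I,
      (w p.1 * w p.2 : ℂ) * (ψ p.1 x * starRingEnd ℂ (ψ p.2 x))) ν :=
    integrable_finsetSum _ fun p _ => (hψψ p.1 p.2).const_mul _
  have hs2 : Integrable (fun x => ‖∑ i ∈ I, w i * ψ i x‖ ^ 2) ν := by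
    refine (hint.re).congr (Eventually.of_forall fun x => ?_)
    simp only
    rw [← he x]
    exact Complex.ofReal_re _
  refine Real.le_sqrt_of_sq_le ((sq_integral_norm_le hs hs2).trans ?_)
  have h1 : ((∫ x, ‖∑ i ∈ I, w i * ψ i x‖ ^ 2 ∂ν : ℝ) : ℂ) = ∑ p ∈ I ×ˢ I,
      (w p.1 * w p.2 : ℂ) * ∫ x, ψ p.1 x * starRingEnd ℂ (ψ p.2 x) ∂ν := by
    rw [← integral_complex_ofReal]
    simp_rw [he]
    rw [integral_finsetSum _ fun p _ => (hψψ p.1 p.2).const_mul _]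
    exact Finset.sum_congr rfl fun p _ => integral_const_mul _ _
  have h2 : ∫ x, ‖∑ i ∈ I, w i * ψ i x‖ ^ 2 ∂ν ≤
      ‖((∫ x, ‖∑ i ∈ I, w i * ψ i x‖ ^ 2 ∂ν : ℝ) : ℂ)‖ := by
    rw [Complex.norm_real]
    exact Real.le_norm_self _
  refine h2.trans ?_
  rw [h1, Finset.card_filter, Nat.cast_sum]
  refine (norm_sum_le _ _).trans (Finset.sum_le_sum fun p hp => ?_)
  obtain ⟨hp1, hp2⟩ := Finset.mem_product.1 hp
  by_cases hrp : r p
  · rw [if_pos hrp, Nat.cast_one, norm_mul, norm_mul, Complex.norm_real, Complex.norm_real,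
      Real.norm_of_nonneg (hw0 _ hp1), Real.norm_of_nonneg (hw0 _ hp2)]
    have h3 : ‖∫ x, ψ p.1 x * starRingEnd ℂ (ψ p.2 x) ∂ν‖ ≤ 1 := by
      refine (norm_integral_le_of_norm_le_const (C := 1) (Eventually.of_forall fun x => ?_)).trans
        (by simp)
      rw [norm_mul, RCLike.norm_conj, hn, hn, one_mul]
    exact mul_le_one₀ (mul_le_one₀ (hw1 _ hp1) (hw0 _ hp2) (hw1 _ hp2)) (norm_nonneg _) h3
  · rw [hr _ hp1 _ hp2 hrp, mul_zero, norm_zero, if_neg hrp, Nat.cast_zero]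

variable {τ κ : Type*} {χ : κ → X → ℂ} {v : τ → κ → ℕ} {R : τ → ℝ → X → X}

/-- The weight of a pair of characters in the carré du champ. -/
noncomputable def pairWeight (v : τ → κ → ℕ) (T : Finset τ) (c : τ → ℝ) (p : κ × κ) : ℝ :=
  ∑ P ∈ T, c P * ((if 0 < v P p.1 then 1 else 0) * v P p.2)

theorem pairWeight_nonneg {T : Finset τ} {c : τ → ℝ} (hc0 : ∀ P, 0 ≤ c P) (p : κ × κ) :
    0 ≤ pairWeight v T c p :=
  Finset.sum_nonneg fun P _ => mul_nonneg (hc0 P)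
    (mul_nonneg (by split_ifs <;> norm_num) (Nat.cast_nonneg _))

theorem pairWeight_le_one {T : Finset τ} {c : τ → ℝ} (hc0 : ∀ P, 0 ≤ c P) {p : κ × κ}
    (hp : ∑ P ∈ T, c P * v P p.2 = 1) : pairWeight v T c p ≤ 1 := by
  rw [← hp]
  refine Finset.sum_le_sum fun P _ => mul_le_mul_of_nonneg_left ?_ (hc0 P)
  split_ifs <;> simp

/-- On the diagonal the indicator is redundant, since it only drops terms with exponent 0. -/
theorem pairWeight_self {T : Finset τ} {c : τ → ℝ} {F : κ} (hF : ∑ P ∈ T, c P * v P F = 1) :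
    pairWeight v T c (F, F) = 1 := by
  rw [← hF]
  refine Finset.sum_congr rfl fun P _ => ?_
  simp only
  split_ifs with h
  · rw [one_mul]
  · rw [Nat.eq_zero_of_not_pos h]
    simp

theorem exists_of_pairWeight_ne_zero {T : Finset τ} {c : τ → ℝ} {p : κ × κ}
    (h : pairWeight v T c p ≠ 0) : ∃ P ∈ T, 0 < v P p.1 ∧ 0 < v P p.2 := by
  obtain ⟨P, hP, h⟩ := Finset.exists_ne_zero_of_sum_ne_zero h
  refine ⟨P, hP, ?_, ?_⟩
  · by_contra h0
    exact h (by rw [if_neg h0]; ring)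
  · by_contra h0
    exact h (by rw [Nat.eq_zero_of_not_pos h0]; simp)

omit [MeasurableSpace X] in
theorem gammaConj_eq (T : Finset τ) (A : Finset κ) (c : τ → ℝ) (a : ℝ) (x : X) :
    gammaConj χ v T A c a x = a ^ 2 * ∑ p ∈ A ×ˢ A,
      pairWeight v T c p * (χ p.1 x * starRingEnd ℂ (χ p.2 x)) := by
  rw [gammaConj]
  congr 1
  simp only [partSum, derivSum, pairWeight, map_sum, Finset.mul_sum,
    Finset.sum_product, Complex.ofReal_sum, Finset.sum_mul]
  conv_rhs => rw [Finset.sum_comm]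
  rw [Finset.sum_comm]
  refine Finset.sum_congr rfl fun F _ => ?_
  rw [Finset.sum_comm]
  refine Finset.sum_congr rfl fun G _ => Finset.sum_congr rfl fun P _ => ?_
  rw [map_mul, Complex.conj_natCast]
  split_ifs <;> push_cast <;> ring

omit [MeasurableSpace X] in
theorem gammaSelf_eq (T : Finset τ) (A : Finset κ) (c : τ → ℝ) (a : ℝ) (x : X) :
    gammaSelf χ v T A c a x = a ^ 2 * ∑ p ∈ A ×ˢ A,
      pairWeight v T c p * (χ p.1 x * χ p.2 x) := by
  rw [gammaSelf]
  congr 1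
  simp only [partSum, derivSum, pairWeight, Finset.mul_sum,
    Finset.sum_product, Complex.ofReal_sum, Finset.sum_mul]
  conv_rhs => rw [Finset.sum_comm]
  rw [Finset.sum_comm]
  refine Finset.sum_congr rfl fun F _ => ?_
  rw [Finset.sum_comm]
  refine Finset.sum_congr rfl fun G _ => Finset.sum_congr rfl fun P _ => ?_
  split_ifs <;> push_cast <;> ring

theorem exp_int_mul_ne_one {k : ℤ} (hk : k ≠ 0) :
    Complex.exp (k * (Real.pi / k : ℝ) * Complex.I) ≠ 1 := by
  have hk' : (k : ℂ) ≠ 0 := by exact_mod_cast hk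
  have : (k * (Real.pi / k : ℝ) * Complex.I : ℂ) = Real.pi * Complex.I := by
    push_cast
    field_simp
  rw [this, Complex.exp_pi_mul_I]
  norm_num

omit [IsProbabilityMeasure ν] in
/-- A ratio of products of two characters integrates to zero unless the exponents agree. -/
theorem IsRotated.integral_ratio_eq_zero (h : IsRotated ν χ v R) {F G F' G' : κ} {P : τ}
    (hP : v P F + v P G ≠ v P F' + v P G') :
    ∫ x, χ F x * χ G x * (starRingEnd ℂ (χ F' x) * starRingEnd ℂ (χ G' x)) ∂ν = 0 := by
  set k : ℤ := (v P F + v P G : ℤ) - (v P F' + v P G') with hk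
  have hk0 : k ≠ 0 := by
    rw [hk, sub_ne_zero]
    exact_mod_cast hP
  have hconj := Complex.continuous_conj.measurable
  -- Rotation by π / k, with k the difference of the exponents, changes the sign of the integrand.
  refine integral_eq_zero_of_eigen (h.preserving P (Real.pi / k)) ?_ (exp_int_mul_ne_one hk0)
    fun x => ?_
  · exact ((h.measurable F).mul (h.measurable G)).mul
      ((hconj.comp (h.measurable F')).mul (hconj.comp (h.measurable G')))
  · simp only [h.rotate, map_mul, ← Complex.exp_conj, Complex.conj_I, Complex.conj_ofReal,
      Complex.conj_natCast]
    have : (k * (Real.pi / k : ℝ) * Complex.I : ℂ) = v P F * (Real.pi / k : ℝ) * Complex.I +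
        v P G * (Real.pi / k : ℝ) * Complex.I + (v P F' * (Real.pi / k : ℝ) * -Complex.I +
        v P G' * (Real.pi / k : ℝ) * -Complex.I) := by
      have hk' : (k : ℂ) = v P F + v P G - (v P F' + v P G') := by rw [hk]; push_cast; rfl
      rw [hk']
      ring
    rw [this, Complex.exp_add, Complex.exp_add, Complex.exp_add]
    ring

end SecondMoment

/-! ### The Stein error for rough polynomials -/

section RoughError

variable {K : Type*} [Field K] [Finite K]

/-- Unique factorization, contraposed; both products have degree 2N, whence the cutoff N + N. -/
theorem exists_expo_ne {N z : ℕ} {F G F' G' : K[X]} (hF : F ∈ rough K N z) (hG : G ∈ rough K N z)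
    (hF' : F' ∈ rough K N z) (hG' : G' ∈ rough K N z) (h : F * G ≠ F' * G') :
    ∃ P : PrimePoly K, expo N P F + expo N P G ≠ expo N P F' + expo N P G' := by
  by_contra! hP
  rw [mem_rough] at hF hG hF' hG'
  refine h (eq_of_multiplicity_eq (M := N + N) (hF.1.mul hG.1) (hF'.1.mul hG'.1) ?_ ?_
    fun P _ => ?_)
  · rw [hF.1.natDegree_mul hG.1, hF.2.1, hG.2.1]
  · rw [hF'.1.natDegree_mul hG'.1, hF'.2.1, hG'.2.1]
  · have := hP P
    rw [expo_eq hF.1 hF.2.1.le, expo_eq hG.1 hG.2.1.le, expo_eq hF'.1 hF'.2.1.le,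
      expo_eq hG'.1 hG'.2.1.le] at this
    rw [multiplicity_mul_of_monic hF.1 hG.1, multiplicity_mul_of_monic hF'.1 hG'.1, this]

theorem mem_commonPairs_of_pairWeight_ne_zero {N z : ℕ} {p : K[X] × K[X]}
    (hp : p ∈ rough K N z ×ˢ rough K N z)
    (h : pairWeight (expo N) (primesLE K N) (primeWeight K N) p ≠ 0) : p ∈ commonPairs K N z := by
  obtain ⟨P, -, h1, h2⟩ := exists_of_pairWeight_ne_zero h
  obtain ⟨hF, hG⟩ := Finset.mem_product.1 hp
  refine mem_commonPairs.2 ⟨⟨hF, hG⟩, P, ?_, ?_⟩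
  · rw [mem_rough] at hF
    rwa [expo_eq hF.1 hF.2.1.le, multiplicity_pos_iff_dvd hF.1] at h1
  · rw [mem_rough] at hG
    rwa [expo_eq hG.1 hG.2.1.le, multiplicity_pos_iff_dvd hG.1] at h2

theorem integral_norm_gammaSelf_le {N : ℕ} (hN : 1 ≤ N) (z : ℕ) (a : ℝ) :
    ∫ x, ‖gammaSelf (torusChar N) (expo N) (primesLE K N) (rough K N z) (primeWeight K N) a x‖
      ∂(torusMeasure K) ≤
      a ^ 2 * Real.sqrt (2 * (rough K N z).card + 3 * energyBound K N z) := by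
  classical
  have hrot := isRotated_torusChar (K := K) N
  have hle := card_product_quadruples_le (K := K) N z
  have e : ∀ x, ‖gammaSelf (torusChar N) (expo N) (primesLE K N) (rough K N z)
      (primeWeight K N) a x‖ = a ^ 2 * ‖∑ p ∈ commonPairs K N z,
        pairWeight (expo N) (primesLE K N) (primeWeight K N) p *
          (torusChar N p.1 x * torusChar N p.2 x)‖ := by
    intro x
    rw [gammaSelf_eq, norm_mul, norm_pow, Complex.norm_real, Real.norm_eq_abs, sq_abs]
    congr 2
    refine (Finset.sum_subset (Finset.filter_subset _ _) fun p hp hp' => ?_).symm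
    have : pairWeight (expo N) (primesLE K N) (primeWeight K N) p = 0 := by
      by_contra h0
      exact hp' (mem_commonPairs_of_pairWeight_ne_zero hp h0)
    rw [this]
    simp
  simp_rw [e]
  rw [integral_const_mul]
  refine mul_le_mul_of_nonneg_left ?_ (sq_nonneg a)
  refine (integral_norm_sum_le (r := fun r : (K[X] × K[X]) × (K[X] × K[X]) =>
    r.1.1 * r.1.2 = r.2.1 * r.2.2) (commonPairs K N z)
    (fun p _ => pairWeight_nonneg (primeWeight_nonneg N) p) (fun p hp => ?_)
    (ψ := fun (p : K[X] × K[X]) x => torusChar N p.1 x * torusChar N p.2 x)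
    (fun p => (hrot.measurable p.1).mul (hrot.measurable p.2))
    (fun p x => by rw [norm_mul, hrot.norm, hrot.norm, one_mul]) ?_).trans ?_
  · exact pairWeight_le_one (primeWeight_nonneg N)
      (sum_weight_mul_expo hN (mem_commonPairs.1 hp).1.2)
  · intro p hp p' hp' hr
    obtain ⟨P, hP⟩ := exists_expo_ne (mem_commonPairs.1 hp).1.1 (mem_commonPairs.1 hp).1.2
      (mem_commonPairs.1 hp').1.1 (mem_commonPairs.1 hp').1.2 hr
    simp_rw [map_mul]
    exact hrot.integral_ratio_eq_zero hP
  · refine Real.sqrt_le_sqrt ?_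
    have := (Nat.cast_le (α := ℝ)).2 hle
    push_cast at this
    convert! this

theorem integral_norm_gammaConj_sub_one_le {N : ℕ} (hN : 1 ≤ N) (z : ℕ) {a : ℝ}
    (ha : a ^ 2 * (rough K N z).card = 1) :
    ∫ x, ‖gammaConj (torusChar N) (expo N) (primesLE K N) (rough K N z) (primeWeight K N) a x - 1‖
      ∂(torusMeasure K) ≤
      a ^ 2 * Real.sqrt (2 * (rough K N z).card + 3 * energyBound K N z) := by
  classical
  have hrot := isRotated_torusChar (K := K) N
  have hle := card_ratio_quadruples_le (K := K) N z
  set I := (commonPairs K N z).filter (fun p => p.1 ≠ p.2) with hI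
  have hIc : ∀ p ∈ I, p ∈ commonPairs K N z := fun p hp => (Finset.mem_filter.1 hp).1
  have e : ∀ x, ‖gammaConj (torusChar N) (expo N) (primesLE K N) (rough K N z)
      (primeWeight K N) a x - 1‖ = a ^ 2 * ‖∑ p ∈ I,
        pairWeight (expo N) (primesLE K N) (primeWeight K N) p *
          (torusChar N p.1 x * starRingEnd ℂ (torusChar N p.2 x))‖ := by
    intro x
    rw [gammaConj_eq, ← Finset.sum_filter_add_sum_filter_not _ (fun p => p.1 = p.2), mul_add]
    -- Diagonal terms have weight 1 and |χ_F|² = 1, so they sum to a²|A| = 1 and cancel the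
    -- subtracted 1.
    have h1 : (a : ℂ) ^ 2 * ∑ p ∈ (rough K N z ×ˢ rough K N z).filter (fun p => p.1 = p.2),
        (pairWeight (expo N) (primesLE K N) (primeWeight K N) p : ℂ) *
          (torusChar N p.1 x * starRingEnd ℂ (torusChar N p.2 x)) = 1 := by
      have h2 : ∀ p ∈ (rough K N z ×ˢ rough K N z).filter (fun p => p.1 = p.2),
          (pairWeight (expo N) (primesLE K N) (primeWeight K N) p : ℂ) *
          (torusChar N p.1 x * starRingEnd ℂ (torusChar N p.2 x)) = 1 := by
        rintro ⟨F, G⟩ hp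
        simp only [Finset.mem_filter, Finset.mem_product] at hp
        obtain ⟨⟨hF, -⟩, rfl⟩ := hp
        rw [pairWeight_self (sum_weight_mul_expo hN hF), Complex.mul_conj', hrot.norm]
        simp
      have h3 : ((rough K N z ×ˢ rough K N z).filter (fun p => p.1 = p.2)).card =
          (rough K N z).card := by
        rw [← Finset.diag_card (rough K N z)]
        congr 1
        ext ⟨F, G⟩
        simp only [Finset.mem_filter, Finset.mem_product, Finset.mem_diag]
        exact ⟨fun h => ⟨h.1.1, h.2⟩, fun h => ⟨⟨h.1, h.2 ▸ h.1⟩, h.2⟩⟩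
      rw [Finset.sum_congr rfl h2, Finset.sum_const, h3, nsmul_eq_mul, mul_one]
      exact_mod_cast ha
    rw [h1, add_sub_cancel_left, norm_mul, norm_pow, Complex.norm_real, Real.norm_eq_abs, sq_abs]
    congr 2
    refine (Finset.sum_subset (fun p hp => ?_) fun p hp hp' => ?_).symm
    · rw [hI, Finset.mem_filter] at hp
      exact Finset.mem_filter.2 ⟨(Finset.mem_filter.1 hp.1).1, hp.2⟩
    · rw [Finset.mem_filter] at hp
      have : pairWeight (expo N) (primesLE K N) (primeWeight K N) p = 0 := by
        by_contra h0
        exact hp' (Finset.mem_filter.2 ⟨mem_commonPairs_of_pairWeight_ne_zero hp.1 h0, hp.2⟩)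
      rw [this]
      simp
  simp_rw [e]
  rw [integral_const_mul]
  refine mul_le_mul_of_nonneg_left ?_ (sq_nonneg a)
  refine (integral_norm_sum_le (r := fun r : (K[X] × K[X]) × (K[X] × K[X]) =>
    r.1.1 * r.2.2 = r.2.1 * r.1.2) I
    (fun p _ => pairWeight_nonneg (primeWeight_nonneg N) p) (fun p hp => ?_)
    (ψ := fun (p : K[X] × K[X]) x => torusChar N p.1 x * starRingEnd ℂ (torusChar N p.2 x))
    (fun p => (hrot.measurable p.1).mul
      (Complex.continuous_conj.measurable.comp (hrot.measurable p.2)))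
    (fun p x => by rw [norm_mul, RCLike.norm_conj, hrot.norm, hrot.norm, one_mul]) ?_).trans ?_
  · exact pairWeight_le_one (primeWeight_nonneg N)
      (sum_weight_mul_expo hN (mem_commonPairs.1 (hIc p hp)).1.2)
  · intro p hp p' hp' hr
    have m1 := (mem_commonPairs.1 (hIc p hp)).1
    have m2 := (mem_commonPairs.1 (hIc p' hp')).1
    -- Equality of the ratios F/G and F'/G' is cross-multiplied to F G' = F' G, so the second
    -- entries change sides.
    obtain ⟨P, hP⟩ := exists_expo_ne m1.1 m2.2 m2.1 m1.2 hr
    rw [← hrot.integral_ratio_eq_zero hP]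
    refine integral_congr_ae (Eventually.of_forall fun x => ?_)
    simp only [map_mul, Complex.conj_conj]
    ring
  · refine Real.sqrt_le_sqrt ?_
    have := (Nat.cast_le (α := ℝ)).2 hle
    push_cast at this
    convert! this

/-- The relative size of the nontrivial solutions of `F₁ F₂ = F₃ F₄` in rough polynomials. -/
noncomputable def energyRatio (K : Type*) [Field K] [Finite K] (N z : ℕ) : ℝ :=
  (2 * (rough K N z).card + 3 * energyBound K N z) / (rough K N z).card ^ 2

theorem norm_charFun_sub_le {Ω : Type*} [MeasurableSpace Ω] {μ : Measure Ω}
    [IsProbabilityMeasure μ] {f : K[X] → Ω → ℂ} (hf : IsSteinhaus μ f) {N z : ℕ} (hN : 1 ≤ N)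
    (hA : 0 < (rough K N z).card) (t : ℂ) :
    ‖charFun (μ.map (normalizedSum f (rough K N z))) t - charFun stdComplexNormal t‖ ≤
      ‖t‖ ^ 2 * Real.exp (‖t‖ ^ 2 / 4) * Real.sqrt (energyRatio K N z) := by
  have hrot := isRotated_torusChar (K := K) N
  rw [hf.map_normalizedSum, charFun_map_eq_integral_expRe (hrot.measurable_sum _ _),
    charFun_stdComplexNormal]
  set a : ℝ := 1 / Real.sqrt ((rough K N z).card : ℝ) with ha
  have hA' : (0 : ℝ) < (rough K N z).card := by exact_mod_cast hA
  have ha2 : a ^ 2 = 1 / (rough K N z).card := by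
    rw [ha, div_pow, one_pow, Real.sq_sqrt hA'.le]
  have ha1 : a ^ 2 * (rough K N z).card = 1 := by
    rw [ha2]
    field_simp
  have h := hrot.norm_integral_expRe_sub_le (T := primesLE K N) (A := rough K N z)
    (c := primeWeight K N) (fun F hF => sum_weight_mul_expo hN hF) a t
  refine h.trans ?_
  have h1 := integral_norm_gammaSelf_le (K := K) hN z a
  have h2 := integral_norm_gammaConj_sub_one_le (K := K) hN z ha1
  have h3 : a ^ 2 * Real.sqrt (2 * (rough K N z).card + 3 * energyBound K N z) =
      Real.sqrt (energyRatio K N z) := by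
    rw [energyRatio, Real.sqrt_div (by positivity), Real.sqrt_sq hA'.le, ha2]
    ring
  rw [h3] at h1 h2
  calc _ ≤ ‖t‖ ^ 2 / 2 * Real.exp (‖t‖ ^ 2 / 4) * (Real.sqrt (energyRatio K N z) +
        Real.sqrt (energyRatio K N z)) :=
        mul_le_mul_of_nonneg_left (add_le_add h2 h1) (by positivity)
    _ = _ := by ring

end RoughError

/-! ### Asymptotics and convergence in distribution -/

section Limit

variable {K : Type*} [Field K] [Finite K]

/-- The factor z⁴ is shared among the four rough counts in each summand, and each is bounded by
`mul_card_rough_le`. -/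
theorem energyBound_mul_le (N z : ℕ) :
    energyBound K N z * z ^ 4 ≤ N * (Nat.card K ^ N) ^ 2 := by
  rw [energyBound, Finset.sum_mul]
  have h : ∀ m ∈ Finset.Ioo 0 N, (rough K m z).card ^ 2 * (rough K (N - m) z).card ^ 2 * z ^ 4 ≤
      (Nat.card K ^ N) ^ 2 := by
    intro m hm
    rw [Finset.mem_Ioo] at hm
    calc _ = (z * (rough K m z).card) ^ 2 * (z * (rough K (N - m) z).card) ^ 2 := by ring
      _ ≤ (Nat.card K ^ m) ^ 2 * (Nat.card K ^ (N - m)) ^ 2 :=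
        Nat.mul_le_mul (Nat.pow_le_pow_left (mul_card_rough_le z (by omega)) 2)
          (Nat.pow_le_pow_left (mul_card_rough_le z (by omega)) 2)
      _ = _ := by rw [← mul_pow, ← pow_add, Nat.add_sub_cancel' hm.2.le]
  refine (Finset.sum_le_sum h).trans ?_
  rw [Finset.sum_const, smul_eq_mul, Nat.card_Ioo]
  exact Nat.mul_le_mul_right _ (by omega)

theorem card_rough_pos {N z : ℕ} (hz2 : 2 ≤ z) (hz4 : 4 * z ≤ 2 ^ (z / 2))
    (hzN : z < N) (hNz : N ≤ z ^ 2) : 0 < (rough K N z).card := by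
  have h := pow_le_mul_card_rough (K := K) hz2 hz4 hzN hNz
  have hq : (0 : ℝ) < (Nat.card K : ℝ) ^ N := by
    have := two_le_card (K := K)
    positivity
  by_contra h0
  rw [Nat.eq_zero_of_not_pos h0] at h
  simp only [Nat.cast_zero, mul_zero] at h
  linarith

/-- The lower bound for |A| gives 1/|A| ≤ 4z / q^N ≤ 4N / 2^N and E/|A|² ≤ 16 N / z², both uniformly
in q. -/
theorem energyRatio_le {N z : ℕ} (hz2 : 2 ≤ z) (hz4 : 4 * z ≤ 2 ^ (z / 2))
    (hzN : z < N) (hNz : N ≤ z ^ 2) :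
    energyRatio K N z ≤ 8 * (N * (1 / 2) ^ N) + 48 * (Real.sqrt N / z) ^ 2 := by
  have hA : (0 : ℝ) < (rough K N z).card := by exact_mod_cast card_rough_pos hz2 hz4 hzN hNz
  have h := pow_le_mul_card_rough (K := K) hz2 hz4 hzN hNz
  have hE : (energyBound K N z : ℝ) * z ^ 4 ≤ N * ((Nat.card K : ℝ) ^ N) ^ 2 := by
    exact_mod_cast energyBound_mul_le (K := K) N z
  have hz0 : (0 : ℝ) < z := by positivity
  have hzN' : (z : ℝ) ≤ N := by exact_mod_cast hzN.le
  have hq : (2 : ℝ) ^ N ≤ (Nat.card K : ℝ) ^ N :=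
    pow_le_pow_left₀ zero_le_two (by exact_mod_cast two_le_card (K := K)) N
  set A : ℝ := ((rough K N z).card : ℝ)
  set Q : ℝ := (Nat.card K : ℝ) ^ N
  have hQ : 0 < Q := lt_of_lt_of_le (by positivity) hq
  have h1 : 1 / A ≤ 4 * (N * (1 / 2) ^ N) := by
    rw [one_div_pow, div_le_iff₀ hA, mul_one_div]
    rw [← mul_div_assoc, div_mul_eq_mul_div, le_div_iff₀ (by positivity), one_mul]
    calc (2 : ℝ) ^ N ≤ 4 * z * A := hq.trans h
      _ ≤ _ := by nlinarith
  have h2 : energyBound K N z / A ^ 2 ≤ 16 * (Real.sqrt N / z) ^ 2 := by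
    rw [div_pow, Real.sq_sqrt (Nat.cast_nonneg N), ← mul_div_assoc,
      div_le_div_iff₀ (by positivity) (by positivity)]
    have hQ2 : Q ^ 2 ≤ (4 * z * A) ^ 2 := pow_le_pow_left₀ hQ.le h 2
    have h3 : (energyBound K N z : ℝ) * z ^ 4 ≤ N * (4 * z * A) ^ 2 :=
      hE.trans (mul_le_mul_of_nonneg_left hQ2 (Nat.cast_nonneg N))
    refine le_of_mul_le_mul_right (a := (z : ℝ) ^ 2) ?_ (by positivity)
    calc _ = (energyBound K N z : ℝ) * z ^ 4 := by ring
      _ ≤ _ := h3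
      _ = _ := by ring
  have h3 : energyRatio K N z = 2 * (1 / A) + 3 * (energyBound K N z / A ^ 2) := by
    change (2 * A + 3 * energyBound K N z) / A ^ 2 = _
    field_simp
  rw [h3]
  linarith

theorem tendsto_energyRatio {ι : Type*} {l : Filter ι} {K : ι → Type*} [∀ i, Field (K i)]
    [∀ i, Finite (K i)] {N z : ι → ℕ} (hN : Tendsto N l atTop)
    (hz : ∀ᶠ i in l, Real.sqrt (N i) ≤ (z i : ℝ) ∧ (z i : ℝ) ≤ (N i : ℝ) - 1)
    (hNz : (fun i => Real.sqrt (N i)) =o[l] (fun i => (z i : ℝ))) :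
    (∀ᶠ i in l, 1 ≤ N i ∧ 0 < (rough (K i) (N i) (z i)).card) ∧
      Tendsto (fun i => energyRatio (K i) (N i) (z i)) l (nhds 0) := by
  have hztop : Tendsto z l atTop := by
    refine tendsto_natCast_atTop_iff.1 (tendsto_atTop_mono' l (hz.mono fun i hi => hi.1) ?_)
    exact Real.tendsto_sqrt_atTop.comp (tendsto_natCast_atTop_atTop.comp hN)
  -- The hypothesis √N ≤ z serves twice: it sends z to infinity and it is the condition N ≤ z² of
  -- the lower bound.
  have hgood : ∀ᶠ i in l, 2 ≤ z i ∧ 4 * z i ≤ 2 ^ (z i / 2) ∧ z i < N i ∧ N i ≤ z i ^ 2 := by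
    filter_upwards [hz, hztop.eventually_ge_atTop 2, hztop.eventually eventually_four_mul_le]
      with i hi h2 h4
    refine ⟨h2, h4, ?_, ?_⟩
    · have : (z i : ℝ) + 1 ≤ N i := by linarith [hi.2]
      exact_mod_cast this
    · have := (Real.sqrt_le_left (Nat.cast_nonneg _)).1 hi.1
      exact_mod_cast this
  refine ⟨hgood.mono fun i hi => ⟨by omega, card_rough_pos hi.1 hi.2.1 hi.2.2.1 hi.2.2.2⟩, ?_⟩
  have hlim : Tendsto (fun i => 8 * ((N i : ℝ) * (1 / 2) ^ N i) +
      48 * (Real.sqrt (N i) / z i) ^ 2) l (nhds (8 * 0 + 48 * 0 ^ 2)) := by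
    refine Tendsto.add (Tendsto.const_mul _ ?_)
      ((hNz.tendsto_div_nhds_zero.pow 2).const_mul _)
    exact (tendsto_self_mul_const_pow_of_lt_one (by norm_num) (by norm_num)).comp hN
  rw [show (8 * 0 + 48 * 0 ^ 2 : ℝ) = 0 by norm_num] at hlim
  refine tendsto_of_tendsto_of_tendsto_of_le_of_le' tendsto_const_nhds hlim
    (Eventually.of_forall fun i => ?_)
    (hgood.mono fun i hi => energyRatio_le hi.1 hi.2.1 hi.2.2.1 hi.2.2.2)
  unfold energyRatio
  positivity

/-- Lévy's convergence theorem along an arbitrary filter, given a rate of convergence. -/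
theorem tendsto_of_norm_charFun_sub_le {ι : Type*} {l : Filter ι} {ρ : ι → ProbabilityMeasure ℂ}
    {ρ₀ : ProbabilityMeasure ℂ} {ε : ι → ℝ} (hε : Tendsto ε l (nhds 0)) {C : ℂ → ℝ}
    (h : ∀ᶠ i in l, ∀ t, ‖charFun (ρ i : Measure ℂ) t - charFun (ρ₀ : Measure ℂ) t‖ ≤
      C t * ε i) : Tendsto ρ l (nhds ρ₀) := by
  set s := {i | ∀ t, ‖charFun (ρ i : Measure ℂ) t - charFun (ρ₀ : Measure ℂ) t‖ ≤ C t * ε i}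
  -- The filter l need not be countably generated, but it lies below one that is and on which the
  -- estimate still holds. There convergence can be tested on sequences, to which Lévy's theorem
  -- applies.
  have hl : l ≤ comap ε (nhds 0) ⊓ 𝓟 s := le_inf (map_le_iff_le_comap.1 hε) (le_principal_iff.2 h)
  refine Tendsto.mono_left (tendsto_of_seq_tendsto fun x hx => ?_) hl
  rw [tendsto_inf, tendsto_principal, tendsto_comap_iff] at hx
  refine ProbabilityMeasure.tendsto_of_tendsto_charFun fun t => ?_
  rw [tendsto_iff_norm_sub_tendsto_zero]
  have h0 : Tendsto (fun n => C t * ε (x n)) atTop (nhds 0) := by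
    simpa using hx.1.const_mul (C t)
  exact squeeze_zero' (Eventually.of_forall fun n => norm_nonneg _)
    (hx.2.mono fun n hn => hn t) h0

end Limit

end RoughCLT

theorem mainTheorem6 {ι : Type*} (l : Filter ι)
    (K : ι → Type*) [∀ i, Field (K i)] [∀ i, Finite (K i)]
    (N z : ι → ℕ) (hN : Tendsto N l atTop)
    (hz : ∀ᶠ i in l, Real.sqrt (N i) ≤ (z i : ℝ) ∧ (z i : ℝ) ≤ (N i : ℝ) - 1)
    (hNz : (fun i => Real.sqrt (N i)) =o[l] (fun i => (z i : ℝ)))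
    (Ω : ι → Type*) [∀ i, MeasurableSpace (Ω i)]
    (μ : ∀ i, Measure (Ω i)) [∀ i, IsProbabilityMeasure (μ i)]
    (f : ∀ i, (K i)[X] → Ω i → ℂ) (hf : ∀ i, RoughCLT.IsSteinhaus (μ i) (f i)) :
    TendstoInDistribution
      (fun i => RoughCLT.normalizedSum (f i) (RoughCLT.rough (K i) (N i) (z i)))
      l (id : ℂ → ℂ) μ RoughCLT.stdComplexNormal := by
  obtain ⟨hpos, hlim⟩ := RoughCLT.tendsto_energyRatio (K := K) hN hz hNz
  refine ⟨fun i => (hf i).aemeasurable_normalizedSum _ _, aemeasurable_id, ?_⟩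
  refine RoughCLT.tendsto_of_norm_charFun_sub_le
    (ε := fun i => Real.sqrt (RoughCLT.energyRatio (K i) (N i) (z i)))
    (C := fun t => ‖t‖ ^ 2 * Real.exp (‖t‖ ^ 2 / 4)) ?_ (hpos.mono fun i hi t => ?_)
  · simpa using hlim.sqrt
  · simp only [ProbabilityMeasure.coe_mk, Measure.map_id]
    exact RoughCLT.norm_charFun_sub_le (hf i) hi.1 hi.2 t
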